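/- Let $\mathcal M\subset\mathbb R^N$ be a compact smooth embedded submanifold of dimension $d$, with volume measure $\mathrm dx$ (the $d$-dimensional Hausdorff measure, normalised so that it is Lebesgue measure on $\mathbb R^d$). Let $\{(U_j,\phi_j)\}_{j\in J}$ be a finite atlas: the sets $U_j\subset\mathcal M$ are open and cover $\mathcal M$, and each $\phi_j$ is a homeomorphism of $U_j$ onto a bounded open set $\phi_j(U_j)\subset\mathbb R^d$. Let $\{\eta_j\}_{j\in J}$ be a partition of unity on $\mathcal M$ with $\mathrm{supp}(\eta_j)\subset U_j$. Let $f\in C(\mathcal M)$, and put $\hat f_j:=(f\,\eta_j)\circ\phi_j^{-1}$ on $\phi_j(U_j)$ and $\hat f_j:=0$ elsewhere in $\mathbb R^d$. Let $\rho\in L^1(\mathbb R)\cap L^2(\mathbb R)$ be an activation function that is not almost everywhere zero. Write $\mathrm{rad}(S):=\sup_{z\in S}\|z\|_2$. For every $\varepsilon>0$ there are constants $\alpha_j,\Omega_j>0$ $(j\in J)$ such that the following holds. Suppose that for $j\in J$ and $k\in\mathbb N$ the random variables $$w_k^{(j)}\sim\mathrm{Unif}\big([-\alpha_j\Omega_j,\alpha_j\Omega_j]^d\big),\qquad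 y_k^{(j)}\sim\mathrm{Unif}(\phi_j(U_j)),\qquad u_k^{(j)}\sim\mathrm{Unif}\big([-\tfrac{\pi}{2}(2L_j+1),\tfrac{\pi}{2}(2L_j+1)]\big),$$ where $L_j:=\lceil\tfrac{2d}{\pi}\mathrm{rad}(\phi_j(U_j))\Omega_j-\tfrac12\rceil$, are all mutually independent, and put $b_k^{(j)}:=-\langle w_k^{(j)},y_k^{(j)}\rangle-\alpha_ju_k^{(j)}$. Then there are hidden-to-output weights $v_k^{(j)}=v_{k,n_j}^{(j)}\in\mathbb R$, $1\le k\le n_j$, which are measurable functions of the weights and biases $\big(w_i^{(j)},b_i^{(j)}\big)_{i=1}^{n_j}$ of the same chart, such that the RVFL networks $$\tilde f_{n_j}(z):=\sum_{k=1}^{n_j}v_k^{(j)}\,\rho\big(\langle w_k^{(j)},z\rangle+b_k^{(j)}\big),\qquad z\in\phi_j(U_j),$$ have the following two properties (the functions $v_{k,n}^{(j)}$ do not depend on the choice of the probability space). 1. For each $j\in J$, $\tilde f_{n_j}$ approximates $\hat f_j$: the squared error $|\hat f_j-\tilde f_{n_j}|^2$ is integrable for the product of the probability measure and Lebesgue measure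 on $\phi_j(U_j)$, and the limit $$\lim_{n_j\to\infty}\mathbb E\int_{\phi_j(U_j)}\big|\hat f_j(z)-\tilde f_{n_j}(z)\big|^2\,\mathrm dz$$ exists and is $<\varepsilon$, with convergence to this limit at rate $O(1/n_j)$. 2. The squared error $\big|f(x)-\sum_{\{j\in J:\,x\in U_j\}}\tilde f_{n_j}(\phi_j(x))\big|^2$ is integrable for the product of the probability measure and the volume measure of $\mathcal M$, and, as all $n_j$ tend to infinity simultaneously, the limit $$\lim_{\{n_j\}_{j\in J}\to\infty}\mathbb E\int_{\mathcal M}\Big|f(x)-\sum_{\{j\in J:\,x\in U_j\}}\tilde f_{n_j}(\phi_j(x))\Big|^2\,\mathrm dx$$ exists and is $<\varepsilon$, with convergence to this limit at rate $O(1/\min_{j\in J}n_j)$. -/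

import Mathlib

open MeasureTheory ProbabilityTheory Filter Topology
open scoped Manifold ContDiff

noncomputable section

/-- Euclidean space `ℝ^d` with its Euclidean norm and inner product. -/
abbrev Euc (d : ℕ) : Type := EuclideanSpace ℝ (Fin d)

/-- The radius `rad(S) = sup_{x ∈ S} ‖x‖` of a (bounded) set. -/
def rad {d : ℕ} (S : Set (Euc d)) : ℝ := sSup ((fun x => ‖x‖) '' S)

/-- The integer `L = ⌈(2d/π) rad(S) Ω - 1/2⌉`. -/
def phaseIndex {d : ℕ} (S : Set (Euc d)) (Ω : ℝ) : ℤ :=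
  ⌈2 * (d : ℝ) / Real.pi * rad S * Ω - 1 / 2⌉

/-- The cube `[-r, r]^d`. -/
def cube (d : ℕ) (r : ℝ) : Set (Euc d) := {w | ∀ i, w i ∈ Set.Icc (-r) r}

/-- The interval `[-(π/2)(2L+1), (π/2)(2L+1)]`, with `L = ⌈(2d/π) rad(S) Ω - 1/2⌉`. -/
def phaseInterval {d : ℕ} (S : Set (Euc d)) (Ω : ℝ) : Set ℝ :=
  Set.Icc (-(Real.pi / 2 * (2 * (phaseIndex S Ω : ℝ) + 1)))
    (Real.pi / 2 * (2 * (phaseIndex S Ω : ℝ) + 1))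

/-- The uniform probability distribution on a set `S` with `0 < vol(S) < ∞`. -/
def unif {E : Type*} [MeasureSpace E] (S : Set E) : Measure E :=
  ProbabilityTheory.cond (volume : Measure E) S

/-- The joint law of one triple `(w, y, u)` of independent random variables with
`w ∼ Unif([-αΩ, αΩ]^d)`, `y ∼ Unif(S)` and `u ∼ Unif([-(π/2)(2L+1), (π/2)(2L+1)])`. -/
def sampleLaw {d : ℕ} (S : Set (Euc d)) (α Ω : ℝ) : Measure (Euc d × Euc d × ℝ) :=
  (unif (cube d (α * Ω))).prod ((unif S).prod (unif (phaseInterval S Ω)))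

/-- All the random variables `w j k`, `y j k`, `u j k` (for `j ∈ J` and `k ∈ ℕ`) are mutually
independent, with `w j k ∼ Unif([-α_j Ω_j, α_j Ω_j]^d)`, `y j k ∼ Unif(T j)` and
`u j k ∼ Unif([-(π/2)(2L_j+1), (π/2)(2L_j+1)])`: the triples are independent of each other, and
the law of each triple is the product of the three uniform distributions. -/
structure IsRandomSample {d : ℕ} {J S : Type*} [MeasurableSpace S] (P : Measure S)
    (T : J → Set (Euc d)) (α Ω : J → ℝ)
    (w y : J → ℕ → S → Euc d) (u : J → ℕ → S → ℝ) : Prop where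
  law : ∀ j k, HasLaw (fun s => (w j k s, y j k s, u j k s)) (sampleLaw (T j) (α j) (Ω j)) P
  indep : iIndepFun (fun (p : J × ℕ) (s : S) => (w p.1 p.2 s, y p.1 p.2 s, u p.1 p.2 s)) P

/-- The bias `b = -⟨w, y⟩ - α u`. -/
def bias {d : ℕ} (α : ℝ) (w y : Euc d) (u : ℝ) : ℝ := -(inner ℝ w y) - α * u

/-- A network with one hidden layer of `n` nodes, `z ↦ ∑_k v_k ρ(⟨w_k, z⟩ + b_k)`, given by its
input-to-hidden weights and biases `(w_k, b_k)` and its hidden-to-output weights `v_k`. -/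
def network {d n : ℕ} (ρ : ℝ → ℝ) (wb : Fin n → Euc d × ℝ) (v : Fin n → ℝ) (z : Euc d) : ℝ :=
  ∑ k, v k * ρ (inner ℝ (wb k).1 z + (wb k).2)

/-- The RVFL network with `n` nodes on one chart: the inner weights and biases are the first `n`
random samples, and the outer weights are a function `v` of those weights and biases. -/
def rvfl {d : ℕ} {S : Type*} (ρ : ℝ → ℝ) (α : ℝ) (w y : ℕ → S → Euc d) (u : ℕ → S → ℝ)
    (n : ℕ) (v : (Fin n → Euc d × ℝ) → Fin n → ℝ) (s : S) (z : Euc d) : ℝ :=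
  let wb : Fin n → Euc d × ℝ := fun k => (w k s, bias α (w k s) (y k s) (u k s))
  network ρ wb (v wb) z

open Classical in
/-- The chart function `f̂ = (f · η) ∘ φ⁻¹` on `φ(U)`, extended by zero to `ℝ^d`. -/
def chartFun {d : ℕ} {M : Type*} [TopologicalSpace M] (f η : M → ℝ)
    (φ : OpenPartialHomeomorph M (Euc d)) (z : Euc d) : ℝ :=
  if z ∈ φ.target then f (φ.symm z) * η (φ.symm z) else 0

open Classical in
/-- The sum `∑_{j : x ∈ U_j} g_j(φ_j(x))` over the charts whose domain contains `x`. -/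
def chartSum {d : ℕ} {M J : Type*} [TopologicalSpace M] [Fintype J]
    (φ : J → OpenPartialHomeomorph M (Euc d)) (g : J → Euc d → ℝ) (x : M) : ℝ :=
  ∑ j ∈ Finset.univ.filter (fun j => x ∈ (φ j).source), g j (φ j x)

/-- The squared error `|f̂(z) - f̃_n(z)|²` of one network at `z`, for the outcome `s`. -/
def chartSqError {d : ℕ} {S : Type*} (ρ : ℝ → ℝ) (α : ℝ) (w y : ℕ → S → Euc d) (u : ℕ → S → ℝ)
    (n : ℕ) (v : (Fin n → Euc d × ℝ) → Fin n → ℝ) (fhat : Euc d → ℝ) (s : S) (z : Euc d) : ℝ :=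
  |fhat z - rvfl ρ α w y u n v s z| ^ 2

/-- The squared error `|f(x) - ∑_{j : x ∈ U_j} f̃_{n_j}(φ_j(x))|²` at the point `x` of `M`, for the
outcome `s`. -/
def manifoldSqError {d : ℕ} {M J S : Type*} [TopologicalSpace M] [Fintype J]
    (φ : J → OpenPartialHomeomorph M (Euc d)) (ρ : ℝ → ℝ) (α : J → ℝ)
    (w y : J → ℕ → S → Euc d) (u : J → ℕ → S → ℝ) (n : J → ℕ)
    (v : (j : J) → (Fin (n j) → Euc d × ℝ) → Fin (n j) → ℝ) (f : M → ℝ) (s : S) (x : M) : ℝ :=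
  |f x - chartSum φ (fun j => rvfl ρ (α j) (w j) (y j) (u j) (n j) (v j) s) x| ^ 2

/-- The error `e i` has a limit along `l` that is smaller than `ε`, and it converges to this limit
at the rate `O(r i)`. -/
def TendstoBelowAtRate {ι : Type*} (l : Filter ι) (e r : ι → ℝ) (ε : ℝ) : Prop :=
  ∃ c < ε, Tendsto e l (𝓝 c) ∧ (fun i => e i - c) =O[l] r

end

/-!
Since `ρ` is integrable and does not vanish almost everywhere, its Fourier transform is nonzero at
some nonzero frequency. Weighting translates of `ρ` by a truncated character of that frequency
recovers the plane waves, and by the Stone–Weierstrass theorem every continuous function is, on a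
compact set, uniformly close to a superposition `z ↦ ∫ G (w, b) ρ (⟨w, z⟩ + b) d(w, b)` with `G`
bounded and of bounded support.

For large `α`, the random inner weight and bias have a constant density on the support of `G`. Up to
this constant, which the outer weights absorb, the superposition is therefore the expectation of
`G (w, b) ρ (⟨w, z⟩ + b)`, and the network is the empirical mean of independent copies of that
random variable. Its mean squared error is the square of its bias, which does not depend on the
number `n` of nodes, plus a variance that is a constant multiple of `1 / n`. The errors of the
charts add up to the error on the manifold, where the partition of unity turns the sum of the chart
functions into `f`.
-/

section Fourier

open scoped FourierTransform

variable {V F : Type*} [NormedAddCommGroup V] [InnerProductSpace ℝ V] [FiniteDimensional ℝ V]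
  [MeasurableSpace V] [BorelSpace V] [NormedAddCommGroup F] [NormedSpace ℂ F] [CompleteSpace F]
  {f : V → F}

theorem ae_eq_zero_of_fourier_ae_eq_zero (hf : Integrable f) (h : 𝓕 f =ᵐ[volume] 0) :
    f =ᵐ[volume] 0 := by
  refine ae_eq_zero_of_integral_contDiff_smul_eq_zero hf.locallyIntegrable fun g hg hgc => ?_
  have hgc' : HasCompactSupport fun x => (g x : ℂ) := hgc.comp_left Complex.ofReal_zero
  let G : SchwartzMap V ℂ := hgc'.toSchwartzMap (Complex.ofRealCLM.contDiff.comp hg)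
  let H : SchwartzMap V ℂ := 𝓕⁻ G
  have hH (x : V) : 𝓕 (H : V → ℂ) x = g x := by
    rw [← SchwartzMap.fourier_coe, FourierTransform.fourier_fourierInv_eq]
    rfl
  calc ∫ x, g x • f x = ∫ x, 𝓕 (H : V → ℂ) x • f x := by simp [hH]
    _ = ∫ ξ, H ξ • 𝓕 f ξ := by
      have h := VectorFourier.integral_fourierIntegral_smul_eq_flip (L := innerₗ V)
        Real.continuous_fourierChar continuous_inner H.integrable hf (μ := volume) (ν := volume)
      rwa [flip_innerₗ] at h
    _ = 0 := integral_eq_zero_of_ae (h.mono fun ξ hξ => by simp [hξ])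

theorem exists_ne_zero_fourier_ne_zero [Nontrivial V] (hf : Integrable f)
    (hf0 : ¬ f =ᵐ[volume] 0) : ∃ ξ ≠ 0, 𝓕 f ξ ≠ 0 := by
  contrapose! hf0
  exact ae_eq_zero_of_fourier_ae_eq_zero hf ((Measure.ae_ne volume 0).mono hf0)

theorem exists_integral_mul_comp_add_eq_cos {ρ : ℝ → ℝ} (hρ : Integrable ρ)
    (hρ0 : ¬ ρ =ᵐ[volume] 0) :
    ∃ θ : ℝ, θ ≠ 0 ∧ ∀ c : ℝ, ∃ γ : ℝ → ℝ, Continuous γ ∧ (∃ C, ∀ b, |γ b| ≤ C) ∧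
      ∀ s, ∫ b, γ b * ρ (s + b) = Real.cos (θ * s + c) := by
  have hρ0' : ¬ (fun t => (ρ t : ℂ)) =ᵐ[volume] 0 := fun h =>
    hρ0 (h.mono fun t ht => Complex.ofReal_eq_zero.1 ht)
  obtain ⟨ξ, hξ, ha⟩ := exists_ne_zero_fourier_ne_zero hρ.ofReal hρ0'
  set a : ℂ := 𝓕 (fun t => (ρ t : ℂ)) ξ
  refine ⟨2 * Real.pi * ξ, by positivity, fun c => ?_⟩
  let g : ℝ → ℂ := fun b => Complex.exp (c * Complex.I) / a * 𝐞 (-(b * ξ))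
  have hg_cont : Continuous g := by fun_prop
  have hg_norm (b : ℝ) : ‖g b‖ = ‖a‖⁻¹ := by
    rw [norm_mul, norm_div, Complex.norm_exp_ofReal_mul_I, Circle.norm_coe, one_div, mul_one]
  refine ⟨fun b => (g b).re, by fun_prop,
    ⟨‖a‖⁻¹, fun b => (Complex.abs_re_le_norm _).trans_eq (hg_norm b)⟩, fun s => ?_⟩
  have hint : Integrable fun b => g b * ρ (s + b) :=
    (hρ.comp_add_left s).ofReal.bdd_mul hg_cont.aestronglyMeasurable
      (ae_of_all _ fun b => (hg_norm b).le)
  have htranslate : ∫ b, (𝐞 (-(b * ξ)) : ℂ) * ρ (s + b) = 𝐞 (s * ξ) * a := by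
    have h := congrFun (Fourier.fourierIntegral_comp_add_right Real.fourierChar volume
      (fun t => (ρ t : ℂ)) s) ξ
    simpa [Fourier.fourierIntegral_def, Circle.smul_def, add_comm, a, Real.fourier_real_eq] using h
  have hcomplex : ∫ b, g b * ρ (s + b) = Complex.exp (↑(2 * Real.pi * ξ * s + c) * Complex.I) := by
    simp only [g, mul_assoc, integral_const_mul, htranslate]
    rw [Real.fourierChar_apply, ← mul_assoc, div_mul_eq_mul_div, ← Complex.exp_add,
      div_mul_cancel₀ _ ha]
    push_cast
    ring_nf
  calc ∫ b, (g b).re * ρ (s + b) = ∫ b, (g b * ρ (s + b)).re := by simp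
    _ = (∫ b, g b * ρ (s + b)).re := integral_re hint
    _ = Real.cos (2 * Real.pi * ξ * s + c) := by rw [hcomplex, Complex.exp_ofReal_mul_I_re]

end Fourier

section Truncation

variable {V F : Type*} [NormedAddCommGroup V] [MeasurableSpace V] [BorelSpace V] {μ : Measure V}

theorem exists_setIntegral_compl_closedBall_lt [NormedAddCommGroup F] {f : V → F}
    (hf : Integrable f μ) {δ : ℝ} (hδ : 0 < δ) :
    ∃ R, ∫ t in (Metric.closedBall 0 R)ᶜ, ‖f t‖ ∂μ < δ := by
  have hlim : Tendsto (fun R => ∫ t in Metric.closedBall 0 R, ‖f t‖ ∂μ) atTop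
      (𝓝 (∫ t, ‖f t‖ ∂μ)) :=
    (aecover_closedBall tendsto_id).integral_tendsto_of_countably_generated hf.norm
  obtain ⟨R, hR⟩ := (hlim.eventually (lt_mem_nhds (sub_lt_self _ hδ))).exists
  have hsplit := integral_add_compl (measurableSet_closedBall (x := (0 : V)) (ε := R)) hf.norm
  exact ⟨R, by linarith⟩

theorem setIntegral_norm_comp_add_left_le [μ.IsAddLeftInvariant] [NormedAddCommGroup F]
    {f : V → F} (hf : Integrable f μ) {s : V} {R D : ℝ} (hs : ‖s‖ ≤ D) :
    ∫ b in (Metric.closedBall 0 (R + D))ᶜ, ‖f (s + b)‖ ∂μ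
      ≤ ∫ t in (Metric.closedBall 0 R)ᶜ, ‖f t‖ ∂μ := by
  have hsub : (Metric.closedBall 0 (R + D))ᶜ ⊆ (s + ·) ⁻¹' (Metric.closedBall (0 : V) R)ᶜ := by
    intro b hb hb'
    simp only [mem_closedBall_zero_iff, Set.mem_compl_iff] at hb hb'
    refine hb ?_
    have h : ‖b‖ ≤ ‖s + b‖ + ‖s‖ := by simpa using norm_sub_le (s + b) s
    linarith
  calc ∫ b in (Metric.closedBall 0 (R + D))ᶜ, ‖f (s + b)‖ ∂μ
      ≤ ∫ b in (s + ·) ⁻¹' (Metric.closedBall 0 R)ᶜ, ‖f (s + b)‖ ∂μ :=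
        setIntegral_mono_set (hf.comp_add_left s).norm.integrableOn
          (ae_of_all _ fun _ => norm_nonneg _) hsub.eventuallyLE
    _ = ∫ t in (Metric.closedBall 0 R)ᶜ, ‖f t‖ ∂μ :=
        (measurePreserving_add_left μ s).setIntegral_preimage_emb
          (measurableEmbedding_addLeft s) (fun t => ‖f t‖) _

theorem exists_norm_integral_sub_setIntegral_closedBall_le [μ.IsAddLeftInvariant]
    [NormedRing F] [NormedSpace ℝ F] {f g : V → F} (hf : Integrable f μ)
    (hg : AEStronglyMeasurable g μ) {C : ℝ} (hC : ∀ b, ‖g b‖ ≤ C) (D : ℝ) {δ : ℝ} (hδ : 0 < δ) :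
    ∃ R, ∀ s, ‖s‖ ≤ D →
      ‖∫ b, g b * f (s + b) ∂μ - ∫ b in Metric.closedBall 0 R, g b * f (s + b) ∂μ‖ ≤ δ := by
  have hC0 : 0 ≤ C := (norm_nonneg _).trans (hC 0)
  obtain ⟨R, hR⟩ := exists_setIntegral_compl_closedBall_lt hf (δ := δ / (C + 1)) (by positivity)
  refine ⟨R + D, fun s hs => ?_⟩
  have hint : Integrable (fun b => g b * f (s + b)) μ :=
    (hf.comp_add_left s).bdd_mul hg (ae_of_all _ hC)
  rw [← integral_add_compl (measurableSet_closedBall (x := (0 : V)) (ε := R + D)) hint,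
    add_sub_cancel_left]
  calc ‖∫ b in (Metric.closedBall 0 (R + D))ᶜ, g b * f (s + b) ∂μ‖
      ≤ ∫ b in (Metric.closedBall 0 (R + D))ᶜ, C * ‖f (s + b)‖ ∂μ := by
        refine norm_integral_le_of_norm_le
          ((hf.comp_add_left s).norm.integrableOn.const_mul C) (ae_of_all _ fun b => ?_)
        exact (norm_mul_le _ _).trans (by gcongr; exact hC b)
    _ = C * ∫ b in (Metric.closedBall 0 (R + D))ᶜ, ‖f (s + b)‖ ∂μ := integral_const_mul ..
    _ ≤ C * (δ / (C + 1)) := by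
        gcongr
        exact (setIntegral_norm_comp_add_left_le hf hs).trans hR.le
    _ ≤ δ := by
        rw [mul_div_assoc', div_le_iff₀ (by positivity)]
        nlinarith

end Truncation

section InnerProduct

variable {E : Type*} [NormedAddCommGroup E] [InnerProductSpace ℝ E] {A K : Set E}

theorem exists_forall_mem_closedBall_abs_comp_inner_sub_le (hK : Bornology.IsBounded K)
    {g : ℝ → ℝ} (hg : UniformContinuous g) (w₀ : E) {ε : ℝ} (hε : 0 < ε) :
    ∃ r > 0, ∀ w ∈ Metric.closedBall w₀ r, ∀ z ∈ K, |g (inner ℝ w z) - g (inner ℝ w₀ z)| ≤ ε := by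
  obtain ⟨M, hM0, hM⟩ : ∃ M > 0, ∀ z ∈ K, ‖z‖ ≤ M := hK.exists_pos_norm_le
  obtain ⟨δ, hδ, hgδ⟩ := Metric.uniformContinuous_iff.1 hg ε hε
  refine ⟨δ / (2 * M), by positivity, fun w hw z hz => (hgδ ?_).le⟩
  rw [Real.dist_eq, ← inner_sub_left]
  calc |inner ℝ (w - w₀) z| ≤ ‖w - w₀‖ * ‖z‖ := abs_real_inner_le_norm _ z
    _ ≤ δ / (2 * M) * M := by
      gcongr
      exacts [mem_closedBall_iff_norm.1 hw, hM z hz]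
    _ = δ / 2 := by field_simp
    _ < δ := half_lt_self hδ

theorem exists_forall_abs_integral_sub_setIntegral_le {ρ : ℝ → ℝ} (hρ : Integrable ρ)
    (hA : Bornology.IsBounded A) (hK : Bornology.IsBounded K) {γ : ℝ → ℝ}
    (hγ : Measurable γ) (hγ_bdd : ∃ C, ∀ b, |γ b| ≤ C) {ε : ℝ} (hε : 0 < ε) :
    ∃ R, ∀ w ∈ A, ∀ z ∈ K, |(∫ b, γ b * ρ (inner ℝ w z + b))
      - ∫ b in Metric.closedBall 0 R, γ b * ρ (inner ℝ w z + b)| ≤ ε := by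
  obtain ⟨C, hC⟩ := hγ_bdd
  obtain ⟨D, hD0, hD⟩ : ∃ D > 0, ∀ w ∈ A, ‖w‖ ≤ D := hA.exists_pos_norm_le
  obtain ⟨M, -, hM⟩ : ∃ M > 0, ∀ z ∈ K, ‖z‖ ≤ M := hK.exists_pos_norm_le
  obtain ⟨R, hR⟩ := exists_norm_integral_sub_setIntegral_closedBall_le hρ
    hγ.aestronglyMeasurable hC (D * M) hε
  refine ⟨R, fun w hw z hz => hR _ ((norm_inner_le_norm w z).trans ?_)⟩
  gcongr
  exacts [hD w hw, hM z hz]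

end InnerProduct

section Ridge

variable {p : ENNReal} {ρ : ℝ → ℝ}

theorem measurePreserving_prodMk_add {Y : Type*} [MeasurableSpace Y] (ν : Measure Y) [SFinite ν]
    {a : Y → ℝ} (ha : Measurable a) :
    MeasurePreserving (fun q : Y × ℝ => (q.1, a q.1 + q.2)) (ν.prod volume) (ν.prod volume) :=
  (MeasurePreserving.id ν).skew_product (g := fun y b => a y + b) (by fun_prop)
    (ae_of_all _ fun y => (measurePreserving_add_left volume (a y)).map_eq)

theorem memLp_mul_comp_add {Y : Type*} [MeasurableSpace Y] {ν : Measure Y} [SFinite ν]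
    (hρ : MemLp ρ p volume) {A : Set Y} (hA : MeasurableSet A) (hνA : ν A ≠ ⊤)
    {a : Y → ℝ} (ha : Measurable a) {g : Y × ℝ → ℝ} (hg : Measurable g)
    {C : ℝ} (hC : ∀ q, |g q| ≤ C) (hgA : Function.support g ⊆ A ×ˢ Set.univ) :
    MemLp (fun q => g q * ρ (a q.1 + q.2)) p (ν.prod volume) := by
  have := isFiniteMeasure_restrict.2 hνA
  have hshift : MemLp (fun q : Y × ℝ => ρ (a q.1 + q.2)) p ((ν.restrict A).prod volume) :=
    (hρ.comp_snd _).comp_measurePreserving (measurePreserving_prodMk_add _ ha)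
  have hmul : MemLp (fun q : Y × ℝ => g q * ρ (a q.1 + q.2)) p
      ((ν.prod volume).restrict (A ×ˢ Set.univ)) := by
    rw [← Measure.prod_restrict, Measure.restrict_univ]
    exact hshift.mul (memLp_top_of_bound hg.aestronglyMeasurable C (ae_of_all _ hC))
  rw [← Set.indicator_eq_self.2 ((Function.support_mul_subset_left _ _).trans hgA)]
  exact (memLp_indicator_iff_restrict (hA.prod .univ)).2 hmul

variable {E : Type*} [NormedAddCommGroup E] [MeasurableSpace E]

/-- The densities of the distributions of inner weights and biases `(w, b)` over which ridge
functions are superposed: bounded measurable functions with bounded support. -/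
structure IsBoundedWeight (G : E × ℝ → ℝ) : Prop where
  measurable : Measurable G
  bounded : ∃ C, ∀ p, |G p| ≤ C
  isBounded_support : Bornology.IsBounded (Function.support G)

namespace IsBoundedWeight

variable {G H : E × ℝ → ℝ}

theorem zero : IsBoundedWeight (0 : E × ℝ → ℝ) :=
  ⟨measurable_zero, ⟨0, by simp⟩, by simp⟩

theorem add (hG : IsBoundedWeight G) (hH : IsBoundedWeight H) : IsBoundedWeight (G + H) where
  measurable := hG.measurable.add hH.measurable
  bounded := by
    obtain ⟨C, hC⟩ := hG.bounded
    obtain ⟨D, hD⟩ := hH.bounded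
    exact ⟨C + D, fun p => (abs_add_le _ _).trans (add_le_add (hC p) (hD p))⟩
  isBounded_support :=
    (hG.isBounded_support.union hH.isBounded_support).subset (Function.support_add G H)

theorem const_smul (hG : IsBoundedWeight G) (a : ℝ) : IsBoundedWeight (a • G) where
  measurable := hG.measurable.const_smul a
  bounded := by
    obtain ⟨C, hC⟩ := hG.bounded
    refine ⟨|a| * C, fun p => ?_⟩
    rw [Pi.smul_apply, smul_eq_mul, abs_mul]
    exact mul_le_mul_of_nonneg_left (hC p) (abs_nonneg a)
  isBounded_support := hG.isBounded_support.subset (Function.support_const_smul_subset a G)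

theorem indicator_prod {γ : ℝ → ℝ} (hγ : Measurable γ) (hγ_bdd : ∃ C, ∀ b, |γ b| ≤ C)
    {A : Set E} {I : Set ℝ} (hA : MeasurableSet A) (hI : MeasurableSet I)
    (hA_bdd : Bornology.IsBounded A) (hI_bdd : Bornology.IsBounded I) :
    IsBoundedWeight ((A ×ˢ I).indicator fun p => γ p.2) where
  measurable := (hγ.comp measurable_snd).indicator (hA.prod hI)
  bounded := by
    obtain ⟨C, hC⟩ := hγ_bdd
    refine ⟨C, fun p => ?_⟩
    have h : |(A ×ˢ I).indicator (fun p => γ p.2) p| ≤ |γ p.2| :=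
      norm_indicator_le_norm_self (fun p : E × ℝ => γ p.2) p
    exact h.trans (hC p.2)
  isBounded_support := (hA_bdd.prod hI_bdd).subset Set.support_indicator_subset

end IsBoundedWeight

variable [InnerProductSpace ℝ E]

/-- The contribution `G(w, b) ρ(⟨w, z⟩ + b)` at `z` of a hidden node with inner weight and bias
`p = (w, b)`. -/
def node (ρ : ℝ → ℝ) (G : E × ℝ → ℝ) (z : E) (p : E × ℝ) : ℝ := G p * ρ (inner ℝ p.1 z + p.2)

variable [FiniteDimensional ℝ E] [BorelSpace E] {G H : E × ℝ → ℝ}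

namespace IsBoundedWeight

theorem memLp_node (hG : IsBoundedWeight G) (hρ : MemLp ρ p volume) (z : E) :
    MemLp (node ρ G z) p volume := by
  obtain ⟨C, hC⟩ := hG.bounded
  obtain ⟨R, hR⟩ := hG.isBounded_support.subset_closedBall 0
  refine memLp_mul_comp_add hρ (A := Metric.closedBall 0 R) (a := fun w => inner ℝ w z)
    measurableSet_closedBall measure_closedBall_lt_top.ne (by fun_prop) hG.measurable hC
    fun p hp => ⟨?_, trivial⟩
  simpa using (le_max_left _ _).trans (mem_closedBall_zero_iff.1 (hR hp))

theorem memLp_node_prod {X : Type*} [MeasurableSpace X] {μ : Measure X} [IsFiniteMeasure μ]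
    (hG : IsBoundedWeight G) (hρ : MemLp ρ p volume) {ψ : X → E} (hψ : Measurable ψ) :
    MemLp (fun q : (E × ℝ) × X => node ρ G (ψ q.2) q.1) p (volume.prod μ) := by
  obtain ⟨C, hC⟩ := hG.bounded
  obtain ⟨R, hR⟩ := hG.isBounded_support.subset_closedBall 0
  have hreorder : MeasurePreserving (fun q : (E × ℝ) × X => ((q.1.1, q.2), q.1.2))
      (volume.prod μ) (((volume : Measure E).prod μ).prod volume) :=
    (measurePreserving_prodAssoc volume μ volume).symm.comp
      (((MeasurePreserving.id volume).prod Measure.measurePreserving_swap).comp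
        (measurePreserving_prodAssoc volume volume μ))
  have hmem := memLp_mul_comp_add (ν := (volume : Measure E).prod μ)
    (A := Metric.closedBall 0 R ×ˢ Set.univ) (a := fun y => inner ℝ y.1 (ψ y.2))
    (g := fun q => G (q.1.1, q.2)) hρ (measurableSet_closedBall.prod .univ)
    (by
      rw [Measure.prod_prod]
      exact ENNReal.mul_ne_top measure_closedBall_lt_top.ne (measure_ne_top μ _))
    (by fun_prop) (hG.measurable.comp (by fun_prop)) (fun q => hC _)
    fun q hq => ⟨⟨by simpa using (le_max_left _ _).trans (mem_closedBall_zero_iff.1 (hR hq)),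
      trivial⟩, trivial⟩
  exact hmem.comp_measurePreserving hreorder

theorem integrable_node (hG : IsBoundedWeight G) (hρ : Integrable ρ) (z : E) :
    Integrable (node ρ G z) :=
  memLp_one_iff_integrable.1 (hG.memLp_node (memLp_one_iff_integrable.2 hρ) z)

end IsBoundedWeight

/-- The superposition `z ↦ ∫ G(w, b) ρ(⟨w, z⟩ + b) d(w, b)` of ridge functions. -/
noncomputable def ridgeIntegral (ρ : ℝ → ℝ) (G : E × ℝ → ℝ) (z : E) : ℝ := ∫ p, node ρ G z p

theorem ridgeIntegral_add (hρ : Integrable ρ) (hG : IsBoundedWeight G) (hH : IsBoundedWeight H)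
    (z : E) : ridgeIntegral ρ (G + H) z = ridgeIntegral ρ G z + ridgeIntegral ρ H z := by
  simp only [ridgeIntegral]
  rw [← integral_add (hG.integrable_node hρ z) (hH.integrable_node hρ z)]
  simp only [node, Pi.add_apply, add_mul]

theorem ridgeIntegral_const_smul (ρ : ℝ → ℝ) (a : ℝ) (G : E × ℝ → ℝ) (z : E) :
    ridgeIntegral ρ (a • G) z = a * ridgeIntegral ρ G z := by
  simp only [ridgeIntegral, node, Pi.smul_apply, smul_eq_mul, mul_assoc, integral_const_mul]

/-- The functions `f` that are uniform limits on `K` of superpositions of ridge functions with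
profile `ρ`. -/
def IsRidgeLimit (ρ : ℝ → ℝ) (K : Set E) (f : E → ℝ) : Prop :=
  ∀ ε > 0, ∃ G, IsBoundedWeight G ∧ ∀ z ∈ K, |f z - ridgeIntegral ρ G z| ≤ ε

namespace IsRidgeLimit

variable {K : Set E} {f g : E → ℝ}

theorem zero : IsRidgeLimit ρ K 0 :=
  fun ε hε => ⟨0, .zero, fun z _ => by simpa [ridgeIntegral, node] using hε.le⟩

theorem add (hρ : Integrable ρ) (hf : IsRidgeLimit ρ K f) (hg : IsRidgeLimit ρ K g) :
    IsRidgeLimit ρ K (f + g) := by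
  intro ε hε
  obtain ⟨G, hG, hfG⟩ := hf (ε / 2) (half_pos hε)
  obtain ⟨H, hH, hgH⟩ := hg (ε / 2) (half_pos hε)
  refine ⟨G + H, hG.add hH, fun z hz => ?_⟩
  rw [ridgeIntegral_add hρ hG hH, Pi.add_apply, add_sub_add_comm]
  exact (abs_add_le _ _).trans (by linarith [hfG z hz, hgH z hz])

theorem const_smul (hf : IsRidgeLimit ρ K f) (a : ℝ) : IsRidgeLimit ρ K (a • f) := by
  intro ε hε
  obtain ⟨G, hG, hfG⟩ := hf (ε / (|a| + 1)) (by positivity)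
  refine ⟨a • G, hG.const_smul a, fun z hz => ?_⟩
  rw [ridgeIntegral_const_smul, Pi.smul_apply, smul_eq_mul, ← mul_sub, abs_mul]
  have h := (le_div_iff₀ (by positivity)).1 (hfG z hz)
  nlinarith [abs_nonneg (f z - ridgeIntegral ρ G z)]

theorem of_forall_near (h : ∀ ε > 0, ∃ g, IsRidgeLimit ρ K g ∧ ∀ z ∈ K, |f z - g z| ≤ ε) :
    IsRidgeLimit ρ K f := by
  intro ε hε
  obtain ⟨g, hg, hfg⟩ := h (ε / 2) (half_pos hε)
  obtain ⟨G, hG, hgG⟩ := hg (ε / 2) (half_pos hε)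
  exact ⟨G, hG, fun z hz => (abs_sub_le _ (g z) _).trans (by linarith [hfg z hz, hgG z hz])⟩

end IsRidgeLimit

omit [MeasurableSpace E] [FiniteDimensional ℝ E] [BorelSpace E] in
theorem node_indicator_prod (ρ γ : ℝ → ℝ) (A : Set E) (I : Set ℝ) (z : E) :
    node ρ ((A ×ˢ I).indicator fun p => γ p.2) z
      = (A ×ˢ I).indicator fun p => γ p.2 * ρ (inner ℝ p.1 z + p.2) :=
  funext fun _ => (Set.indicator_mul_left (A ×ˢ I) (fun p => γ p.2)
    fun p => ρ (inner ℝ p.1 z + p.2)).symm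

theorem ridgeIntegral_indicator_prod_eq_setAverage {A : Set E} {I : Set ℝ} {γ : ℝ → ℝ} {z : E}
    (hA : MeasurableSet A) (hI : MeasurableSet I)
    (hint : Integrable (node ρ ((A ×ˢ I).indicator fun p => γ p.2) z)) :
    IntegrableOn (fun w => ∫ b in I, γ b * ρ (inner ℝ w z + b)) A ∧
      ridgeIntegral ρ ((volume.real A)⁻¹ • (A ×ˢ I).indicator fun p => γ p.2) z
        = ⨍ w in A, ∫ b in I, γ b * ρ (inner ℝ w z + b) := by
  rw [node_indicator_prod, integrable_indicator_iff (hA.prod hI), Measure.volume_eq_prod] at hint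
  rw [ridgeIntegral_const_smul, ridgeIntegral, node_indicator_prod,
    integral_indicator (hA.prod hI), Measure.volume_eq_prod, setIntegral_prod _ hint,
    setAverage_eq, smul_eq_mul]
  rw [IntegrableOn, ← Measure.prod_restrict] at hint
  exact ⟨hint.integral_prod_left, rfl⟩

-- Ridge functions need a density in `w` as well: the point mass at `w₀` is replaced by the uniform
-- distribution on a small ball around it, and the density in `b` is truncated to a large interval.
theorem isRidgeLimit_comp_inner (hρ : Integrable ρ) {K : Set E} (hK : Bornology.IsBounded K)
    {γ g : ℝ → ℝ} (hγ : Measurable γ) (hγ_bdd : ∃ C, ∀ b, |γ b| ≤ C) (hg : UniformContinuous g)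
    (hγg : ∀ s, ∫ b, γ b * ρ (s + b) = g s) (w₀ : E) :
    IsRidgeLimit ρ K fun z => g (inner ℝ w₀ z) := by
  intro ε hε
  obtain ⟨r, hr, hnear⟩ :=
    exists_forall_mem_closedBall_abs_comp_inner_sub_le hK hg w₀ (half_pos hε)
  obtain ⟨R, htrunc⟩ := exists_forall_abs_integral_sub_setIntegral_le hρ
    (Metric.isBounded_closedBall (x := w₀) (r := r)) hK hγ hγ_bdd (half_pos hε)
  set A : Set E := Metric.closedBall w₀ r
  set I : Set ℝ := Metric.closedBall 0 R
  have hA : MeasurableSet A := measurableSet_closedBall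
  have hw : IsBoundedWeight ((A ×ˢ I).indicator fun p => γ p.2) :=
    .indicator_prod hγ hγ_bdd hA measurableSet_closedBall Metric.isBounded_closedBall
      Metric.isBounded_closedBall
  refine ⟨(volume.real A)⁻¹ • _, hw.const_smul _, fun z hz => ?_⟩
  obtain ⟨hint, haverage⟩ := ridgeIntegral_indicator_prod_eq_setAverage hA measurableSet_closedBall
    (hw.integrable_node hρ z)
  have hmem : ∀ w ∈ A, ∫ b in I, γ b * ρ (inner ℝ w z + b) ∈
      Metric.closedBall (g (inner ℝ w₀ z)) ε := by
    intro w hwA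
    have h := htrunc w hwA z hz
    rw [hγg, abs_sub_comm] at h
    exact (dist_triangle _ (g (inner ℝ w z)) _).trans
      ((add_le_add h (hnear w hwA z hz)).trans_eq (add_halves ε))
  rw [haverage, abs_sub_comm]
  exact mem_closedBall_iff_norm.1 <| (convex_closedBall _ ε).set_average_mem
    Metric.isClosed_closedBall (Metric.measure_closedBall_pos _ _ hr).ne'
    measure_closedBall_lt_top.ne (ae_restrict_of_forall_mem hA hmem) hint

end Ridge

section PlaneWaves

variable {E : Type*} [NormedAddCommGroup E] [InnerProductSpace ℝ E]

/-- The plane wave `z ↦ cos(⟨w, z⟩ + c)`; the plane waves span the algebra of real trigonometric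
polynomials. -/
noncomputable def planeWave (w : E) (c : ℝ) : C(E, ℝ) :=
  ⟨fun z => Real.cos (inner ℝ w z + c), by fun_prop⟩

theorem planeWave_apply (w : E) (c : ℝ) (z : E) :
    planeWave w c z = Real.cos (inner ℝ w z + c) :=
  rfl

theorem planeWave_mul (w w' : E) (c c' : ℝ) :
    planeWave w c * planeWave w' c' =
      (1 / 2 : ℝ) • (planeWave (w + w') (c + c') + planeWave (w - w') (c - c')) := by
  ext z
  have h := Real.two_mul_cos_mul_cos (inner ℝ w z + c) (inner ℝ w' z + c')
  simp only [planeWave_apply, ContinuousMap.mul_apply, ContinuousMap.smul_apply,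
    ContinuousMap.add_apply, inner_add_left, inner_sub_left, smul_eq_mul, add_add_add_comm,
    sub_add_sub_comm]
  linarith

variable (E) in
/-- The algebra of real trigonometric polynomials on `E`, to which the Stone–Weierstrass theorem is
applied. -/
noncomputable def trigAlgebra : Subalgebra ℝ C(E, ℝ) :=
  (Submodule.span ℝ (Set.range fun p : E × ℝ => planeWave p.1 p.2)).toSubalgebra
    (Submodule.subset_span ⟨0, by ext; simp [planeWave_apply]⟩)
    fun f g hf hg => by
      refine Submodule.span_induction₂ (p := fun f g _ _ => f * g ∈ Submodule.span ℝ _)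
        ?_ ?_ ?_ ?_ ?_ ?_ ?_ hf hg
      · rintro _ _ ⟨⟨w, c⟩, rfl⟩ ⟨⟨w', c'⟩, rfl⟩
        rw [planeWave_mul]
        exact Submodule.smul_mem _ _ (add_mem (Submodule.subset_span ⟨(_, _), rfl⟩)
          (Submodule.subset_span ⟨(_, _), rfl⟩))
      · simp
      · simp
      · exact fun f g h _ _ _ hf hg => add_mul f g h ▸ add_mem hf hg
      · exact fun f g h _ _ _ hg hh => mul_add f g h ▸ add_mem hg hh
      · exact fun a f g _ _ h => smul_mul_assoc a f g ▸ Submodule.smul_mem _ a h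
      · exact fun a f g _ _ h => mul_smul_comm a f g ▸ Submodule.smul_mem _ a h

theorem planeWave_mem_trigAlgebra (w : E) (c : ℝ) : planeWave w c ∈ trigAlgebra E :=
  Submodule.subset_span ⟨(w, c), rfl⟩

theorem trigAlgebra_separatesPoints : (trigAlgebra E).SeparatesPoints := by
  intro x y hxy
  set w : E := (‖x - y‖ ^ 2)⁻¹ • (x - y)
  have hn : ‖x - y‖ ≠ 0 := norm_ne_zero_iff.2 (sub_ne_zero.2 hxy)
  have hw : inner ℝ w x - inner ℝ w y = 1 := by
    rw [← inner_sub_right, real_inner_smul_left, real_inner_self_eq_norm_sq,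
      inv_mul_cancel₀ (pow_ne_zero 2 hn)]
  refine ⟨_, ⟨_, planeWave_mem_trigAlgebra w (-inner ℝ w y), rfl⟩, ?_⟩
  change planeWave w _ x ≠ planeWave w _ y
  rw [planeWave_apply, planeWave_apply, ← sub_eq_add_neg, hw, add_neg_cancel, Real.cos_zero]
  exact (Real.cos_one_le.trans_lt (by norm_num)).ne

theorem isRidgeLimit_of_continuous [MeasurableSpace E] [BorelSpace E] [FiniteDimensional ℝ E]
    {ρ : ℝ → ℝ} (hρ : Integrable ρ) (hρ0 : ¬ ρ =ᵐ[volume] 0) {K : Set E} (hK : IsCompact K)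
    {f : E → ℝ} (hf : Continuous f) : IsRidgeLimit ρ K f := by
  obtain ⟨θ, hθ, hcos⟩ := exists_integral_mul_comp_add_eq_cos hρ hρ0
  have hwave (w : E) (c : ℝ) : IsRidgeLimit ρ K (planeWave w c) := by
    obtain ⟨γ, hγ, hγ_bdd, hγcos⟩ := hcos c
    have huc : UniformContinuous fun s => Real.cos (θ * s + c) :=
      Real.lipschitzWith_cos.uniformContinuous.comp
        ((uniformContinuous_id.const_mul' θ).add uniformContinuous_const)
    convert isRidgeLimit_comp_inner hρ hK.isBounded hγ.measurable hγ_bdd huc hγcos (θ⁻¹ • w)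
      using 2 with z
    rw [planeWave_apply, real_inner_smul_left, mul_inv_cancel_left₀ hθ]
  refine .of_forall_near fun ε hε => ?_
  obtain ⟨g, hg, hgf⟩ :=
    ContinuousMap.exists_mem_subalgebra_near_continuous_of_isCompact_of_separatesPoints
      trigAlgebra_separatesPoints ⟨f, hf⟩ hK hε
  refine ⟨g, ?_, fun z hz => (norm_sub_rev _ _).trans_le (hgf z hz).le⟩
  refine Submodule.span_induction (p := fun (g : C(E, ℝ)) _ => IsRidgeLimit ρ K g) ?_ .zero
    (fun _ _ _ _ => .add hρ) (fun a _ _ h => h.const_smul a) hg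
  rintro _ ⟨p, rfl⟩
  exact hwave p.1 p.2

end PlaneWaves

section Sampling

variable {d : ℕ} {T : Set (Euc d)} {α Ω r : ℝ}

theorem cube_eq_preimage (d : ℕ) (r : ℝ) :
    cube d r = (WithLp.ofLp : Euc d → Fin d → ℝ) ⁻¹' (Set.Icc (fun _ => -r) fun _ => r) := by
  ext w
  simp [cube, Pi.le_def, forall_and]

theorem measurableSet_cube (d : ℕ) (r : ℝ) : MeasurableSet (cube d r) := by
  rw [cube_eq_preimage]
  exact (PiLp.volume_preserving_ofLp (Fin d)).measurable measurableSet_Icc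

theorem volume_cube (d : ℕ) (r : ℝ) :
    (volume : Measure (Euc d)) (cube d r) = ENNReal.ofReal (2 * r) ^ d := by
  rw [cube_eq_preimage, (PiLp.volume_preserving_ofLp (Fin d)).measure_preimage
    measurableSet_Icc.nullMeasurableSet, Real.volume_Icc_pi]
  simp [two_mul]

theorem closedBall_subset_cube (d : ℕ) (r : ℝ) : Metric.closedBall (0 : Euc d) r ⊆ cube d r :=
  fun w hw i => abs_le.1 ((PiLp.norm_apply_le w i).trans (mem_closedBall_zero_iff.1 hw))

theorem abs_inner_le_of_mem_cube {w : Euc d} (hw : w ∈ cube d r) (y : Euc d) :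
    |inner ℝ w y| ≤ r * (d * ‖y‖) := by
  have hterm (i : Fin d) : |y i * w i| ≤ ‖y‖ * r := by
    rw [abs_mul]
    exact mul_le_mul (PiLp.norm_apply_le y i) (abs_le.2 (hw i)) (abs_nonneg _) (norm_nonneg _)
  calc |inner ℝ w y| = |∑ i, y i * w i| := by simp [PiLp.inner_apply]
    _ ≤ ∑ i, |y i * w i| := Finset.abs_sum_le_sum_abs _ _
    _ ≤ ∑ _i : Fin d, ‖y‖ * r := Finset.sum_le_sum fun i _ => hterm i
    _ = r * (d * ‖y‖) := by
      rw [Finset.sum_const, Finset.card_univ, Fintype.card_fin, nsmul_eq_mul]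
      ring

theorem rad_nonneg (T : Set (Euc d)) : 0 ≤ rad T :=
  Real.sSup_nonneg (by rintro _ ⟨x, -, rfl⟩; exact norm_nonneg x)

theorem norm_le_rad (hT : Bornology.IsBounded T) {x : Euc d} (hx : x ∈ T) : ‖x‖ ≤ rad T := by
  obtain ⟨C, hC⟩ := hT.exists_norm_le
  exact le_csSup ⟨C, by rintro _ ⟨y, hy, rfl⟩; exact hC y hy⟩ ⟨x, hx, rfl⟩

/-- Half the length of the phase interval. -/
noncomputable def phaseRadius (T : Set (Euc d)) (Ω : ℝ) : ℝ :=
  Real.pi / 2 * (2 * (phaseIndex T Ω : ℝ) + 1)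

theorem phaseInterval_eq_Icc (T : Set (Euc d)) (Ω : ℝ) :
    phaseInterval T Ω = Set.Icc (-phaseRadius T Ω) (phaseRadius T Ω) :=
  rfl

theorem two_mul_rad_le_phaseRadius (T : Set (Euc d)) (Ω : ℝ) :
    2 * (d * rad T * Ω) ≤ phaseRadius T Ω := by
  have hceil : 2 * (d : ℝ) / Real.pi * rad T * Ω - 1 / 2 ≤ phaseIndex T Ω := Int.le_ceil _
  calc 2 * (d * rad T * Ω)
      = Real.pi / 2 * (2 * (2 * (d : ℝ) / Real.pi * rad T * Ω - 1 / 2) + 1) := by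
        field_simp
        ring
    _ ≤ phaseRadius T Ω := by unfold phaseRadius; gcongr

theorem pi_div_two_le_phaseRadius (T : Set (Euc d)) (hΩ : 0 ≤ Ω) :
    Real.pi / 2 ≤ phaseRadius T Ω := by
  have hindex : (0 : ℝ) ≤ phaseIndex T Ω := by
    have hnonneg : 0 ≤ 2 * (d : ℝ) / Real.pi * rad T * Ω := by
      have := rad_nonneg T
      positivity
    have : -1 < phaseIndex T Ω := Int.lt_ceil.2 (by push_cast; linarith)
    exact_mod_cast (by lia : 0 ≤ phaseIndex T Ω)
  exact le_mul_of_one_le_right (by positivity) (by linarith)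

theorem phaseRadius_pos (T : Set (Euc d)) (hΩ : 0 ≤ Ω) : 0 < phaseRadius T Ω :=
  Real.pi_div_two_pos.trans_le (pi_div_two_le_phaseRadius T hΩ)

-- The length of the phase interval is chosen for this: `α * phaseRadius T Ω` is at least twice as
-- large as `|⟨w, y⟩|`, so truncating the phase does not affect biases up to half of that bound.
theorem mem_phaseInterval_of_abs_bias_le (hT : Bornology.IsBounded T) (hα : 0 < α) (hΩ : 0 ≤ Ω)
    {w y : Euc d} {u : ℝ} (hw : w ∈ cube d (α * Ω)) (hy : y ∈ T)
    (hb : |bias α w y u| ≤ α * (phaseRadius T Ω / 2)) : u ∈ phaseInterval T Ω := by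
  have hinner : |inner ℝ w y| ≤ α * (phaseRadius T Ω / 2) :=
    calc |inner ℝ w y| ≤ α * Ω * (d * ‖y‖) := abs_inner_le_of_mem_cube hw y
      _ ≤ α * Ω * (d * rad T) := by gcongr; exact norm_le_rad hT hy
      _ = α * (d * rad T * Ω) := by ring
      _ ≤ α * (phaseRadius T Ω / 2) := by
        gcongr
        linarith [two_mul_rad_le_phaseRadius T Ω]
  have hu : α * |u| ≤ α * phaseRadius T Ω :=
    calc α * |u| = |bias α w y u + inner ℝ w y| := by
          rw [bias, neg_sub_comm, sub_add_cancel, abs_neg, abs_mul, abs_of_pos hα]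
      _ ≤ α * (phaseRadius T Ω / 2) + α * (phaseRadius T Ω / 2) :=
        (abs_add_le _ _).trans (add_le_add hb hinner)
      _ = α * phaseRadius T Ω := by ring
  exact abs_le.1 (le_of_mul_le_mul_left hu hα)

/-- The inner weight and bias `(w, b)` of the hidden node that is drawn as the triple
`(w, y, u)`. -/
noncomputable def innerParam (α : ℝ) (t : Euc d × Euc d × ℝ) : Euc d × ℝ :=
  (t.1, bias α t.1 t.2.1 t.2.2)

theorem measurable_innerParam (α : ℝ) : Measurable (innerParam (d := d) α) := by
  unfold innerParam bias
  fun_prop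

theorem map_bias_volume (hα : α ≠ 0) (w y : Euc d) :
    (volume : Measure ℝ).map (bias α w y) = ENNReal.ofReal |α⁻¹| • volume := by
  have hcomp : bias α w y = (fun b => -inner ℝ w y - b) ∘ (α * ·) := rfl
  rw [hcomp, ← Measure.map_map (by fun_prop) (by fun_prop), Real.map_volume_mul_left hα,
    Measure.map_smul, (Measure.measurePreserving_sub_left volume _).map_eq]

theorem map_innerParam_prod_prod_volume (hα : α ≠ 0) (μ τ : Measure (Euc d)) [SFinite μ]
    [IsFiniteMeasure τ] :
    (μ.prod (τ.prod volume)).map (innerParam α)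
      = (τ Set.univ * ENNReal.ofReal |α⁻¹|) • μ.prod volume := by
  have hshear : MeasurePreserving (fun q : (Euc d × Euc d) × ℝ => (q.1, bias α q.1.1 q.1.2 q.2))
      ((μ.prod τ).prod volume) ((μ.prod τ).prod (ENNReal.ofReal |α⁻¹| • volume)) :=
    (MeasurePreserving.id _).skew_product (g := fun (q : Euc d × Euc d) u => bias α q.1 q.2 u)
      (by unfold bias; fun_prop) (ae_of_all _ fun q => map_bias_volume hα q.1 q.2)
  have hcomp : innerParam (d := d) α = Prod.map Prod.fst id ∘
      (fun q : (Euc d × Euc d) × ℝ => (q.1, bias α q.1.1 q.1.2 q.2)) ∘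
        MeasurableEquiv.prodAssoc.symm := rfl
  have hassoc := (measurePreserving_prodAssoc μ τ (volume : Measure ℝ)).symm
  rw [hcomp, ← Measure.map_map (by fun_prop) (hshear.measurable.comp hassoc.measurable),
    (hshear.comp hassoc).map_eq, ← Measure.map_prod_map _ _ measurable_fst measurable_id,
    Measure.map_fst_prod, Measure.map_id, Measure.prod_smul_left, Measure.prod_smul_right,
    smul_smul]

theorem sampleLaw_eq_smul_restrict (T : Set (Euc d)) (α Ω : ℝ) :
    sampleLaw T α Ω = (volume (phaseInterval T Ω))⁻¹ •
      ((unif (cube d (α * Ω))).prod ((unif T).prod volume)).restrict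
        {t | t.2.2 ∈ phaseInterval T Ω} := by
  have hset : {t : Euc d × Euc d × ℝ | t.2.2 ∈ phaseInterval T Ω}
      = Set.univ ×ˢ Set.univ ×ˢ phaseInterval T Ω := by ext; simp
  have (S : Set (Euc d)) : SFinite (unif S) := by unfold unif; infer_instance
  rw [hset, ← Measure.prod_restrict, ← Measure.prod_restrict, Measure.restrict_univ,
    Measure.restrict_univ, sampleLaw, unif, ← Measure.prod_smul_right, ← Measure.prod_smul_right]
  rfl

/-- The joint law of the inner weight and bias `(w, b)` of one hidden node. -/
noncomputable def innerLaw (T : Set (Euc d)) (α Ω : ℝ) : Measure (Euc d × ℝ) :=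
  (sampleLaw T α Ω).map (innerParam α)

theorem innerLaw_eq_smul_map_restrict (T : Set (Euc d)) (α Ω : ℝ) :
    innerLaw T α Ω = (volume (phaseInterval T Ω))⁻¹ •
      (((unif (cube d (α * Ω))).prod ((unif T).prod volume)).restrict
        {t | t.2.2 ∈ phaseInterval T Ω}).map (innerParam α) := by
  rw [innerLaw, sampleLaw_eq_smul_restrict, Measure.map_smul]

/-- The density of `innerLaw T α Ω` on the region where it is not affected by the truncation of the
phase. -/
noncomputable def innerDensity (T : Set (Euc d)) (α Ω : ℝ) : ENNReal :=
  (volume (phaseInterval T Ω))⁻¹ * ENNReal.ofReal |α⁻¹| * (volume (cube d (α * Ω)))⁻¹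

theorem innerDensity_ne_top (T : Set (Euc d)) (hα : 0 < α) (hΩ : 0 < Ω) :
    innerDensity T α Ω ≠ ⊤ := by
  have hphase : 0 < phaseRadius T Ω := phaseRadius_pos T hΩ.le
  rw [innerDensity, volume_cube, phaseInterval_eq_Icc, Real.volume_Icc, sub_neg_eq_add]
  refine ENNReal.mul_ne_top (ENNReal.mul_ne_top (ENNReal.inv_ne_top.2 ?_) ENNReal.ofReal_ne_top)
    (ENNReal.inv_ne_top.2 (pow_ne_zero _ ?_)) <;>
  exact (ENNReal.ofReal_pos.2 (by positivity)).ne'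

theorem innerDensity_ne_zero (T : Set (Euc d)) (hα : α ≠ 0) : innerDensity T α Ω ≠ 0 := by
  rw [innerDensity, volume_cube, phaseInterval_eq_Icc, Real.volume_Icc]
  exact mul_ne_zero (mul_ne_zero (ENNReal.inv_ne_zero.2 ENNReal.ofReal_ne_top)
    (ENNReal.ofReal_pos.2 (by positivity)).ne')
    (ENNReal.inv_ne_zero.2 (ENNReal.pow_ne_top ENNReal.ofReal_ne_top))

theorem smul_map_innerParam_eq (hα : α ≠ 0) :
    (volume (phaseInterval T Ω))⁻¹ •
        ((unif (cube d (α * Ω))).prod ((unif T).prod volume)).map (innerParam α)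
      = unif T Set.univ • innerDensity T α Ω • volume.restrict (cube d (α * Ω) ×ˢ Set.univ) := by
  have : SFinite (unif (cube d (α * Ω))) := by unfold unif; infer_instance
  have : IsFiniteMeasure (unif T) := by unfold unif; infer_instance
  have hcube : unif (cube d (α * Ω))
      = (volume (cube d (α * Ω)))⁻¹ • volume.restrict (cube d (α * Ω)) := rfl
  rw [map_innerParam_prod_prod_volume hα, Measure.volume_eq_prod, ← Measure.prod_restrict,
    Measure.restrict_univ, smul_smul, smul_smul, hcube, Measure.prod_smul_left, smul_smul,
    innerDensity]
  congr 1
  ring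

theorem innerLaw_le (T : Set (Euc d)) (Ω : ℝ) (hα : α ≠ 0) :
    innerLaw T α Ω ≤ innerDensity T α Ω • volume := by
  have hT : unif T Set.univ ≤ 1 := by unfold unif; exact prob_le_one
  calc innerLaw T α Ω ≤ (volume (phaseInterval T Ω))⁻¹ •
        ((unif (cube d (α * Ω))).prod ((unif T).prod volume)).map (innerParam α) := by
        rw [innerLaw_eq_smul_map_restrict]
        gcongr
        · exact measurable_innerParam α
        · exact Measure.restrict_le_self
    _ = unif T Set.univ • innerDensity T α Ω • volume.restrict (cube d (α * Ω) ×ˢ Set.univ) :=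
        smul_map_innerParam_eq hα
    _ ≤ (1 : ENNReal) • innerDensity T α Ω • volume := by
        gcongr
        exact Measure.restrict_le_self
    _ = innerDensity T α Ω • volume := one_smul _ _

/-- The inner weights and biases on which the law of a hidden node is uniform. -/
def untruncatedRegion (T : Set (Euc d)) (α Ω : ℝ) : Set (Euc d × ℝ) :=
  cube d (α * Ω) ×ˢ Metric.closedBall 0 (α * (phaseRadius T Ω / 2))

theorem measurableSet_untruncatedRegion (T : Set (Euc d)) (α Ω : ℝ) :
    MeasurableSet (untruncatedRegion T α Ω) :=
  (measurableSet_cube d _).prod measurableSet_closedBall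

theorem innerLaw_restrict_untruncatedRegion (hT : IsOpen T) (hT_bdd : Bornology.IsBounded T)
    (hT_nonempty : T.Nonempty) (hα : 0 < α) (hΩ : 0 ≤ Ω) :
    (innerLaw T α Ω).restrict (untruncatedRegion T α Ω)
      = innerDensity T α Ω • volume.restrict (untruncatedRegion T α Ω) := by
  have hD := measurableSet_untruncatedRegion T α Ω
  have hT_prob : unif T Set.univ = 1 :=
    (cond_isProbabilityMeasure_of_finite (hT.measure_pos volume hT_nonempty).ne'
      hT_bdd.measure_lt_top.ne).measure_univ
  set ν : Measure (Euc d × Euc d × ℝ) := (unif (cube d (α * Ω))).prod ((unif T).prod volume)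
  have hphase : ∀ᵐ t ∂ν, innerParam α t ∈ untruncatedRegion T α Ω →
      t.2.2 ∈ phaseInterval T Ω := by
    have hy : ∀ᵐ t ∂ν, t.2.1 ∈ T :=
      Measure.quasiMeasurePreserving_snd.ae (Measure.quasiMeasurePreserving_fst.ae
        (ae_cond_mem hT.measurableSet))
    filter_upwards [hy] with t hyT ht
    exact mem_phaseInterval_of_abs_bias_le hT_bdd hα hΩ ht.1 hyT (mem_closedBall_zero_iff.1 ht.2)
  calc (innerLaw T α Ω).restrict (untruncatedRegion T α Ω)
      = (volume (phaseInterval T Ω))⁻¹ • (ν.restrict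
          (innerParam α ⁻¹' untruncatedRegion T α Ω ∩ {t | t.2.2 ∈ phaseInterval T Ω})).map
            (innerParam α) := by
        rw [innerLaw_eq_smul_map_restrict, Measure.restrict_smul,
          Measure.restrict_map (measurable_innerParam α) hD,
          Measure.restrict_restrict (measurable_innerParam α hD)]
    _ = ((volume (phaseInterval T Ω))⁻¹ • ν.map (innerParam α)).restrict
          (untruncatedRegion T α Ω) := by
        rw [Measure.restrict_smul, Measure.restrict_map (measurable_innerParam α) hD]
        congr 2
        refine Measure.restrict_congr_set ?_
        filter_upwards [hphase] with t ht
        exact propext (and_iff_left_of_imp ht)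
    _ = innerDensity T α Ω • volume.restrict (untruncatedRegion T α Ω) := by
        rw [smul_map_innerParam_eq hα.ne', hT_prob, one_smul, Measure.restrict_smul,
          Measure.restrict_restrict hD, Set.inter_eq_self_of_subset_left]
        exact Set.prod_mono_right (Set.subset_univ _)

theorem integral_innerLaw_of_support_subset (hT : IsOpen T) (hT_bdd : Bornology.IsBounded T)
    (hT_nonempty : T.Nonempty) (hα : 0 < α) (hΩ : 0 ≤ Ω) {F : Euc d × ℝ → ℝ}
    (hF : Function.support F ⊆ untruncatedRegion T α Ω) :
    ∫ p, F p ∂innerLaw T α Ω = (innerDensity T α Ω).toReal * ∫ p, F p := by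
  have hF_zero : ∀ p ∉ untruncatedRegion T α Ω, F p = 0 :=
    fun p hp => Function.notMem_support.1 fun h => hp (hF h)
  rw [← setIntegral_eq_integral_of_forall_compl_eq_zero hF_zero,
    innerLaw_restrict_untruncatedRegion hT hT_bdd hT_nonempty hα hΩ, integral_smul_measure,
    setIntegral_eq_integral_of_forall_compl_eq_zero hF_zero, smul_eq_mul]

theorem exists_subset_untruncatedRegion {A : Set (Euc d × ℝ)} (hA : Bornology.IsBounded A)
    (T : Set (Euc d)) (hΩ : 0 < Ω) : ∃ α > 0, A ⊆ untruncatedRegion T α Ω := by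
  obtain ⟨R, hR, hAR⟩ := hA.subset_closedBall_lt 0 0
  have hphase : 0 < phaseRadius T Ω := phaseRadius_pos T hΩ.le
  refine ⟨max (R / Ω) (R / (phaseRadius T Ω / 2)), lt_max_of_lt_left (by positivity),
    fun p hp => ?_⟩
  have hpR : p ∈ Metric.closedBall (0 : Euc d) R ×ˢ Metric.closedBall (0 : ℝ) R :=
    closedBall_prod_same (0 : Euc d) (0 : ℝ) R ▸ hAR hp
  refine ⟨closedBall_subset_cube d _ (Metric.closedBall_subset_closedBall ?_ hpR.1),
    Metric.closedBall_subset_closedBall ?_ hpR.2⟩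
  · exact (div_le_iff₀ hΩ).1 (le_max_left _ _)
  · exact (div_le_iff₀ (by positivity)).1 (le_max_right _ _)

theorem exists_isBoundedWeight_abs_sub_integral_node_innerLaw_le {ρ : ℝ → ℝ} (hρ : Integrable ρ)
    (hρ0 : ¬ ρ =ᵐ[volume] 0) (hT : IsOpen T) (hT_bdd : Bornology.IsBounded T)
    {f : Euc d → ℝ} (hf : Continuous f) (hΩ : 0 < Ω) {δ : ℝ} (hδ : 0 < δ) :
    ∃ α > 0, ∃ G, IsBoundedWeight G ∧
      ∀ z ∈ T, |f z - ∫ p, node ρ G z p ∂innerLaw T α Ω| ≤ δ := by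
  obtain ⟨G, hG, hfG⟩ := isRidgeLimit_of_continuous hρ hρ0 hT_bdd.isCompact_closure hf δ hδ
  obtain ⟨α, hα, hGα⟩ := exists_subset_untruncatedRegion hG.isBounded_support T hΩ
  set c := (innerDensity T α Ω).toReal with hc
  have hc0 : c ≠ 0 :=
    ENNReal.toReal_ne_zero.2 ⟨innerDensity_ne_zero T hα.ne', innerDensity_ne_top T hα hΩ⟩
  refine ⟨α, hα, c⁻¹ • G, hG.const_smul _, fun z hz => ?_⟩
  have hsupp : Function.support (node ρ (c⁻¹ • G) z) ⊆ untruncatedRegion T α Ω :=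
    (Function.support_mul_subset_left _ _).trans
      ((Function.support_const_smul_subset c⁻¹ G).trans hGα)
  have hmean : ∫ p, node ρ (c⁻¹ • G) z p ∂innerLaw T α Ω = ridgeIntegral ρ G z := by
    rw [integral_innerLaw_of_support_subset hT hT_bdd ⟨z, hz⟩ hα hΩ.le hsupp, ← hc]
    change c * ridgeIntegral ρ (c⁻¹ • G) z = _
    rw [ridgeIntegral_const_smul, mul_inv_cancel_left₀ hc0]
  exact hmean ▸ hfG z (subset_closure hz)

theorem IsBoundedWeight.memLp_node_innerLaw_prod {p : ENNReal} {ρ : ℝ → ℝ} {G : Euc d × ℝ → ℝ}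
    (hG : IsBoundedWeight G) (hρ : MemLp ρ p volume) (T : Set (Euc d)) (hα : 0 < α) (hΩ : 0 < Ω)
    {X : Type*} [MeasurableSpace X] {μ : Measure X} [IsFiniteMeasure μ] {ψ : X → Euc d}
    (hψ : Measurable ψ) :
    MemLp (fun q : (Euc d × ℝ) × X => node ρ G (ψ q.2) q.1) p ((innerLaw T α Ω).prod μ) := by
  refine (hG.memLp_node_prod (μ := μ) hρ hψ).of_measure_le_smul (innerDensity_ne_top T hα hΩ) ?_
  rw [← Measure.prod_smul_left (μ := volume)]
  exact Measure.prod_mono (innerLaw_le T Ω hα.ne') le_rfl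

end Sampling

section MonteCarlo

theorem integral_sub_sum_sq {S ι : Type*} [MeasurableSpace S] {P : Measure S}
    [IsProbabilityMeasure P] [Fintype ι] {Y : ι → S → ℝ} (hY : ∀ i, MemLp (Y i) 2 P)
    (hind : Pairwise fun i j => IndepFun (Y i) (Y j) P) (a : ℝ) :
    ∫ s, (a - ∑ i, Y i s) ^ 2 ∂P = (a - ∑ i, ∫ s, Y i s ∂P) ^ 2 + ∑ i, Var[Y i; P] := by
  have hsum : MemLp (∑ i, Y i) 2 P := memLp_finsetSum' _ fun i _ => hY i
  have hmean : ∫ s, (∑ i, Y i) s ∂P = ∑ i, ∫ s, Y i s ∂P := by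
    simp only [Finset.sum_apply]
    exact integral_finsetSum _ fun i _ => (hY i).integrable one_le_two
  have hvar := variance_eq_sub ((memLp_const a).sub hsum)
  rw [Pi.sub_def, variance_const_sub hsum.1, IndepFun.variance_sum (fun i _ => hY i)
    (fun i _ j _ hij => hind hij), integral_sub (integrable_const a)
    (hsum.integrable one_le_two), hmean] at hvar
  simp only [integral_const, probReal_univ, one_smul, Pi.pow_apply, Finset.sum_apply] at hvar
  linarith

variable {Ξ S : Type*}

/-- The empirical mean of `h` over the samples `V 0, …, V (n - 1)`; it is `0` for `n = 0`. -/
noncomputable def empiricalMean (h : Ξ → ℝ) (V : ℕ → S → Ξ) (n : ℕ) (s : S) : ℝ :=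
  (n : ℝ)⁻¹ * ∑ k : Fin n, h (V k s)

theorem sum_empiricalMean {J : Type*} [Fintype J] {W : J → ℕ → S → Ξ} (h : J → Ξ → ℝ)
    (n : J → ℕ) (s : S) :
    ∑ j, empiricalMean (h j) (W j) (n j) s
      = ∑ i : Σ j, Fin (n j), (n i.1 : ℝ)⁻¹ * h i.1 (W i.1 i.2 s) := by
  simp only [Fintype.sum_sigma, empiricalMean, Finset.mul_sum]

variable {X : Type*} [MeasurableSpace Ξ] [MeasurableSpace X] {μ : Measure X}

section Moments

variable {Q : Measure Ξ} [IsProbabilityMeasure Q] [SFinite μ] {κ : Ξ × X → ℝ}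

theorem ae_memLp_two_prodMk_right (hκ : MemLp κ 2 (Q.prod μ)) :
    ∀ᵐ x ∂μ, MemLp (fun ξ => κ (ξ, x)) 2 Q := by
  filter_upwards [hκ.1.prodMk_right, hκ.integrable_sq.prod_left_ae] with x hmeas hsq
  exact (memLp_two_iff_integrable_sq hmeas).2 hsq

theorem memLp_two_integral_left (hκ : MemLp κ 2 (Q.prod μ)) :
    MemLp (fun x => ∫ ξ, κ (ξ, x) ∂Q) 2 μ := by
  have hmeas : AEStronglyMeasurable (fun x => ∫ ξ, κ (ξ, x) ∂Q) μ :=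
    hκ.1.prod_swap.integral_prod_right'
  refine (memLp_two_iff_integrable_sq hmeas).2
    (hκ.integrable_sq.integral_prod_right.mono (hmeas.pow 2) ?_)
  filter_upwards [ae_memLp_two_prodMk_right hκ] with x hx
  have hvar := variance_nonneg (fun ξ => κ (ξ, x)) Q
  rw [variance_eq_sub hx, sub_nonneg] at hvar
  exact abs_le_abs_of_nonneg (sq_nonneg _) hvar

theorem integrable_variance_left (hκ : MemLp κ 2 (Q.prod μ)) :
    Integrable (fun x => Var[fun ξ => κ (ξ, x); Q]) μ := by
  refine (hκ.integrable_sq.integral_prod_right.sub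
    (memLp_two_integral_left hκ).integrable_sq).congr ?_
  filter_upwards [ae_memLp_two_prodMk_right hκ] with x hx
  exact (variance_eq_sub hx).symm

end Moments

variable [MeasurableSpace S] {P : Measure S}

theorem memLp_comp_prodMk_of_hasLaw {Q : Measure Ξ} {V : S → Ξ} [SFinite P] [SFinite μ]
    (hV : HasLaw V Q P) {κ : Ξ × X → ℝ} {p : ENNReal} (hκ : MemLp κ p (Q.prod μ)) :
    MemLp (fun q : S × X => κ (V q.1, q.2)) p (P.prod μ) := by
  have hmk : MeasurePreserving (hV.aemeasurable.mk V) P Q :=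
    ⟨hV.aemeasurable.measurable_mk, by
      rw [← Measure.map_congr hV.aemeasurable.ae_eq_mk, hV.map_eq]⟩
  have : SFinite Q := hmk.map_eq ▸ inferInstance
  refine (memLp_congr_ae ?_).1 (hκ.comp_measurePreserving (hmk.prod (MeasurePreserving.id μ)))
  filter_upwards [Measure.quasiMeasurePreserving_fst.ae hV.aemeasurable.ae_eq_mk] with q hq
  simp [Prod.map, hq]

variable {J : Type*} {Q : J → Measure Ξ} {W : J → ℕ → S → Ξ}

theorem pairwise_indepFun_comp_samples (hlaw : ∀ j k, HasLaw (W j k) (Q j) P)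
    (hind : Pairwise fun i i' : J × ℕ => IndepFun (W i.1 i.2) (W i'.1 i'.2) P)
    {g : J → Ξ → ℝ} (hg : ∀ j, AEMeasurable (g j) (Q j)) {n : J → ℕ} :
    Pairwise fun i i' : Σ j, Fin (n j) =>
      IndepFun (fun s => g i.1 (W i.1 i.2 s)) (fun s => g i'.1 (W i'.1 i'.2 s)) P := by
  have hinj : Function.Injective fun i : Σ j, Fin (n j) => ((i.1, i.2) : J × ℕ) := by
    rintro ⟨j, k⟩ ⟨j', k'⟩ h
    obtain ⟨rfl, hk⟩ := Prod.mk.inj h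
    exact congrArg (Sigma.mk j) (Fin.ext hk)
  have hmeas (i : Σ j, Fin (n j)) : AEMeasurable (g i.1) (P.map (W i.1 i.2)) := by
    rw [(hlaw i.1 i.2).map_eq]
    exact hg i.1
  exact fun i i' hii => (hind (hinj.ne hii)).comp₀ (hlaw i.1 i.2).aemeasurable
    (hlaw i'.1 i'.2).aemeasurable (hmeas i) (hmeas i')

variable [Fintype J]

theorem integral_sub_sum_empiricalMean_sq [IsProbabilityMeasure P]
    (hlaw : ∀ j k, HasLaw (W j k) (Q j) P)
    (hind : Pairwise fun i i' : J × ℕ => IndepFun (W i.1 i.2) (W i'.1 i'.2) P)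
    {h : J → Ξ → ℝ} (hh : ∀ j, MemLp (h j) 2 (Q j)) {n : J → ℕ} (hn : ∀ j, n j ≠ 0) (a : ℝ) :
    ∫ s, (a - ∑ j, empiricalMean (h j) (W j) (n j) s) ^ 2 ∂P
      = (a - ∑ j, ∫ ξ, h j ξ ∂Q j) ^ 2 + ∑ j, Var[h j; Q j] / n j := by
  let Y (i : Σ j, Fin (n j)) (s : S) : ℝ := (n i.1 : ℝ)⁻¹ * h i.1 (W i.1 i.2 s)
  have hY (i) : MemLp (Y i) 2 P := by
    have hmem := hh i.1
    rw [← (hlaw i.1 i.2).map_eq] at hmem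
    exact (hmem.comp_of_map (hlaw i.1 i.2).aemeasurable).const_mul _
  have hY_mean (i) : ∫ s, Y i s ∂P = (n i.1 : ℝ)⁻¹ * ∫ ξ, h i.1 ξ ∂Q i.1 := by
    simp only [Y, integral_const_mul]
    congr 1
    exact (hlaw i.1 i.2).integral_comp (hh i.1).1
  have hY_var (i) : Var[Y i; P] = (n i.1 : ℝ)⁻¹ ^ 2 * Var[h i.1; Q i.1] := by
    simp only [Y, variance_const_mul]
    congr 1
    have hmeas := (hh i.1).1.aemeasurable
    rw [← (hlaw i.1 i.2).map_eq] at hmeas ⊢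
    exact (variance_map hmeas (hlaw i.1 i.2).aemeasurable).symm
  have hY_ind : Pairwise fun i i' => IndepFun (Y i) (Y i') P :=
    pairwise_indepFun_comp_samples hlaw hind (g := fun j ξ => (n j : ℝ)⁻¹ * h j ξ)
      fun j => (hh j).1.aemeasurable.const_mul _
  have hn' (j) : (n j : ℝ) ≠ 0 := Nat.cast_ne_zero.2 (hn j)
  simp only [sum_empiricalMean]
  rw [integral_sub_sum_sq hY hY_ind a]
  simp only [hY_mean, hY_var, Fintype.sum_sigma, Finset.sum_const, Finset.card_univ,
    Fintype.card_fin, nsmul_eq_mul]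
  congr 1
  · simp only [mul_inv_cancel_left₀ (hn' _)]
  · refine Finset.sum_congr rfl fun j _ => ?_
    field_simp [hn' j]

variable {F : X → ℝ} {κ : J → Ξ × X → ℝ}

theorem integrable_sub_sum_empiricalMean_sq [IsProbabilityMeasure P] [SFinite μ]
    (hlaw : ∀ j k, HasLaw (W j k) (Q j) P) (hF : MemLp F 2 μ)
    (hκ : ∀ j, MemLp (κ j) 2 ((Q j).prod μ)) (n : J → ℕ) :
    Integrable (fun q : S × X =>
      (F q.2 - ∑ j, empiricalMean (fun ξ => κ j (ξ, q.2)) (W j) (n j) q.1) ^ 2) (P.prod μ) := by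
  refine ((hF.comp_snd P).sub (memLp_finsetSum _ fun j _ => ?_)).integrable_sq
  have hsum : MemLp (fun q : S × X => ∑ k : Fin (n j), κ j (W j k q.1, q.2)) 2 (P.prod μ) :=
    memLp_finsetSum _ fun k _ => memLp_comp_prodMk_of_hasLaw (hlaw j k) (hκ j)
  exact hsum.const_mul _

theorem integral_integral_sub_sum_empiricalMean_sq [IsProbabilityMeasure P] [SFinite μ]
    (hlaw : ∀ j k, HasLaw (W j k) (Q j) P)
    (hind : Pairwise fun i i' : J × ℕ => IndepFun (W i.1 i.2) (W i'.1 i'.2) P)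
    (hF : MemLp F 2 μ) (hκ : ∀ j, MemLp (κ j) 2 ((Q j).prod μ)) {n : J → ℕ}
    (hn : ∀ j, n j ≠ 0) :
    ∫ s, ∫ x, (F x - ∑ j, empiricalMean (fun ξ => κ j (ξ, x)) (W j) (n j) s) ^ 2 ∂μ ∂P
      = ∫ x, (F x - ∑ j, ∫ ξ, κ j (ξ, x) ∂Q j) ^ 2 ∂μ
        + ∑ j, (∫ x, Var[fun ξ => κ j (ξ, x); Q j] ∂μ) / n j := by
  have hQ (j) : IsProbabilityMeasure (Q j) := (hlaw j 0).isProbabilityMeasure_iff.1 inferInstance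
  have hvar (j) : Integrable (fun x => Var[fun ξ => κ j (ξ, x); Q j] / n j) μ :=
    (integrable_variance_left (hκ j)).div_const _
  have hbias : MemLp (fun x => F x - ∑ j, ∫ ξ, κ j (ξ, x) ∂Q j) 2 μ :=
    hF.sub (memLp_finsetSum _ fun j _ => memLp_two_integral_left (hκ j))
  rw [integral_integral_swap (integrable_sub_sum_empiricalMean_sq hlaw hF hκ n)]
  simp only [← integral_div]
  rw [← integral_finsetSum _ fun j _ => hvar j,
    ← integral_add hbias.integrable_sq (integrable_finsetSum _ fun j _ => hvar j)]
  refine integral_congr_ae ?_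
  filter_upwards [ae_all_iff.2 fun j => ae_memLp_two_prodMk_right (hκ j)] with x hx
  exact integral_sub_sum_empiricalMean_sq hlaw hind hx hn (F x)

end MonteCarlo

section Rates

theorem TendstoBelowAtRate.of_eventually_eq_add {ι : Type*} {l : Filter ι} {e b r : ι → ℝ}
    {c ε : ℝ} (hc : c < ε) (he : ∀ᶠ i in l, e i = c + b i) (hb : Tendsto b l (𝓝 0))
    (hbr : b =O[l] r) : TendstoBelowAtRate l e r ε := by
  refine ⟨c, hc, ?_, hbr.congr' (he.mono fun i hi => by simp [hi]) EventuallyEq.rfl⟩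
  simpa using (hb.const_add c).congr' (he.mono fun i hi => hi.symm)

theorem TendstoBelowAtRate.comp {ι ι' : Type*} {l : Filter ι} {l' : Filter ι'} {e r : ι → ℝ} {ε : ℝ}
    (h : TendstoBelowAtRate l e r ε) {g : ι' → ι} (hg : Tendsto g l' l) :
    TendstoBelowAtRate l' (e ∘ g) (r ∘ g) ε :=
  let ⟨c, hc, hlim, hrate⟩ := h
  ⟨c, hc, hlim.comp hg, hrate.comp_tendsto hg⟩

variable {J : Type*}

theorem tendsto_eval_atTop (j : J) : Tendsto (fun n : J → ℕ => n j) atTop atTop :=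
  tendsto_atTop_atTop.2 fun b => ⟨fun _ => b, fun _ hn => hn j⟩

theorem eventually_forall_ne_zero_atTop [Finite J] : ∀ᶠ n : J → ℕ in atTop, ∀ j, n j ≠ 0 :=
  eventually_all.2 fun j => (tendsto_eval_atTop j).eventually_ne_atTop 0

theorem isBigO_div_one_div_iInf [Finite J] (B : ℝ) (j : J) :
    (fun n : J → ℕ => B / n j) =O[atTop] fun n => 1 / ⨅ i, (n i : ℝ) := by
  have : Nonempty J := ⟨j⟩
  refine .of_bound |B| ?_
  filter_upwards [eventually_forall_ne_zero_atTop] with n hn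
  obtain ⟨i, hi⟩ := exists_eq_ciInf_of_finite (f := fun i => (n i : ℝ))
  have hpos : 0 < ⨅ i, (n i : ℝ) := hi ▸ Nat.cast_pos.2 (Nat.pos_of_ne_zero (hn i))
  have hle : ⨅ i, (n i : ℝ) ≤ n j := ciInf_le (Set.finite_range _).bddBelow j
  rw [norm_div, norm_div, norm_one, Real.norm_natCast, Real.norm_of_nonneg hpos.le, mul_one_div,
    Real.norm_eq_abs]
  exact div_le_div_of_nonneg_left (abs_nonneg B) hpos hle

theorem tendstoBelowAtRate_one_div_iInf [Fintype J] {e : (J → ℕ) → ℝ} {c ε : ℝ} {B : J → ℝ}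
    (hc : c < ε) (he : ∀ n : J → ℕ, (∀ j, n j ≠ 0) → e n = c + ∑ j, B j / n j) :
    TendstoBelowAtRate atTop e (fun n => 1 / ⨅ j, (n j : ℝ)) ε := by
  refine .of_eventually_eq_add hc (eventually_forall_ne_zero_atTop.mono he) ?_
    (.fun_sum fun j _ => isBigO_div_one_div_iInf (B j) j)
  simpa using tendsto_finsetSum Finset.univ fun j _ =>
    (tendsto_const_div_atTop_nhds_zero_nat (B j)).comp (tendsto_eval_atTop j)

variable [Fintype J] {Ξ S X : Type*} [MeasurableSpace Ξ] [MeasurableSpace S] [MeasurableSpace X]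
  {P : Measure S} [IsProbabilityMeasure P] {μ : Measure X} [IsFiniteMeasure μ] {F : X → ℝ} {δ ε : ℝ}

theorem tendstoBelowAtRate_sub_sum_empiricalMean {Q : J → Measure Ξ} {W : J → ℕ → S → Ξ}
    {κ : J → Ξ × X → ℝ} (hlaw : ∀ j k, HasLaw (W j k) (Q j) P)
    (hind : Pairwise fun i i' : J × ℕ => IndepFun (W i.1 i.2) (W i'.1 i'.2) P)
    (hF : MemLp F 2 μ) (hκ : ∀ j, MemLp (κ j) 2 ((Q j).prod μ))
    (hbias : ∀ᵐ x ∂μ, |F x - ∑ j, ∫ ξ, κ j (ξ, x) ∂Q j| ≤ δ) (hδ : δ ^ 2 * μ.real Set.univ < ε) :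
    TendstoBelowAtRate atTop
      (fun n : J → ℕ => ∫ s, ∫ x,
        (F x - ∑ j, empiricalMean (fun ξ => κ j (ξ, x)) (W j) (n j) s) ^ 2 ∂μ ∂P)
      (fun n => 1 / ⨅ j, (n j : ℝ)) ε := by
  have hbias_sq : ∀ᵐ x ∂μ, ‖(F x - ∑ j, ∫ ξ, κ j (ξ, x) ∂Q j) ^ 2‖ ≤ δ ^ 2 :=
    hbias.mono fun x hx => by
      rw [norm_pow]
      exact pow_le_pow_left₀ (norm_nonneg _) hx 2
  refine tendstoBelowAtRate_one_div_iInf (lt_of_le_of_lt ?_ hδ) fun n hn =>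
    integral_integral_sub_sum_empiricalMean_sq hlaw hind hF hκ hn
  exact (Real.le_norm_self _).trans (norm_integral_le_of_norm_le_const hbias_sq)

theorem tendstoBelowAtRate_sub_empiricalMean {Q : Measure Ξ} {V : ℕ → S → Ξ} {κ : Ξ × X → ℝ}
    (hlaw : ∀ k, HasLaw (V k) Q P) (hind : Pairwise fun k k' => IndepFun (V k) (V k') P)
    (hF : MemLp F 2 μ) (hκ : MemLp κ 2 (Q.prod μ))
    (hbias : ∀ᵐ x ∂μ, |F x - ∫ ξ, κ (ξ, x) ∂Q| ≤ δ) (hδ : δ ^ 2 * μ.real Set.univ < ε) :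
    TendstoBelowAtRate atTop
      (fun n : ℕ => ∫ s, ∫ x, (F x - empiricalMean (fun ξ => κ (ξ, x)) V n s) ^ 2 ∂μ ∂P)
      (fun n => 1 / (n : ℝ)) ε := by
  have hind' : Pairwise fun i i' : Unit × ℕ => IndepFun (V i.2) (V i'.2) P :=
    fun i i' hii => hind fun h => hii (Prod.ext rfl h)
  have h := tendstoBelowAtRate_sub_sum_empiricalMean (J := Unit) (fun _ => hlaw) hind' hF
    (fun _ => hκ) (by simpa using hbias) hδ
  have hdiag : Tendsto (fun (n : ℕ) (_ : Unit) => n) atTop atTop :=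
    tendsto_atTop_atTop.2 fun b => ⟨b (), fun _ hn _ => hn⟩
  simpa [Function.comp_def] using h.comp hdiag

end Rates

section HausdorffMeasure

theorem euclideanHausdorffMeasure_image_le_of_lipschitzOnWith {X Y : Type*} [EMetricSpace X]
    [EMetricSpace Y] [MeasurableSpace X] [BorelSpace X] [MeasurableSpace Y] [BorelSpace Y]
    {K : NNReal} {f : X → Y} {s : Set X} (hf : LipschitzOnWith K f s) (d : ℕ) :
    Measure.euclideanHausdorffMeasure d (f '' s)
      ≤ (K : ENNReal) ^ (d : ℝ) * Measure.euclideanHausdorffMeasure d s := by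
  simp only [Measure.euclideanHausdorffMeasure_def, Measure.smul_apply]
  rw [ENNReal.smul_def, ENNReal.smul_def, smul_eq_mul, smul_eq_mul, mul_left_comm]
  gcongr
  exact hf.hausdorffMeasure_image_le d.cast_nonneg

theorem isFiniteMeasure_euclideanHausdorffMeasure {d : ℕ} {X F : Type*} [MetricSpace X]
    [CompactSpace X] [MeasurableSpace X] [BorelSpace X] [ChartedSpace (Euc d) X]
    [IsManifold (𝓡 d) 1 X] [NormedAddCommGroup F] [NormedSpace ℝ F] {ι : X → F} {K : NNReal}
    (hι : ContMDiff (𝓡 d) 𝓘(ℝ, F) 1 ι) (hι_anti : AntilipschitzWith K ι) :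
    IsFiniteMeasure (Measure.euclideanHausdorffMeasure d : Measure X) := by
  refine ⟨isCompact_univ.measure_lt_top_of_nhdsWithin fun x _ => ?_⟩
  rw [nhdsWithin_univ]
  set e := extChartAt (𝓡 d) x
  have hsmooth : ContDiffOn ℝ 1 (ι ∘ e.symm) e.target :=
    contMDiffOn_iff_contDiffOn.1 (hι.comp_contMDiffOn (contMDiffOn_extChartAt_symm x))
  obtain ⟨C, t, ht, hC⟩ :=
    (hsmooth.contDiffAt (extChartAt_target_mem_nhds x)).exists_lipschitzOnWith
  have hlip : LipschitzOnWith (K * C) e.symm t := fun a ha b hb =>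
    calc edist (e.symm a) (e.symm b) ≤ K * edist (ι (e.symm a)) (ι (e.symm b)) := hι_anti _ _
      _ ≤ K * (C * edist a b) := by gcongr; exact hC ha hb
      _ = ↑(K * C) * edist a b := by rw [ENNReal.coe_mul, mul_assoc]
  have hball : t ∩ Metric.ball (e x) 1 ∈ 𝓝 (e x) :=
    inter_mem ht (Metric.ball_mem_nhds _ one_pos)
  refine ⟨e.symm '' (t ∩ Metric.ball (e x) 1), ?_, ?_⟩
  · filter_upwards [(continuousAt_extChartAt x).preimage_mem_nhds hball,
      extChartAt_source_mem_nhds (I := 𝓡 d) x] with y hy hy_source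
    exact ⟨e y, hy, e.left_inv hy_source⟩
  · refine (euclideanHausdorffMeasure_image_le_of_lipschitzOnWith
      (hlip.mono Set.inter_subset_left) d).trans_lt (ENNReal.mul_lt_top ?_ ?_)
    · exact ENNReal.rpow_lt_top_of_nonneg d.cast_nonneg ENNReal.coe_ne_top
    · rw [EuclideanSpace.euclideanHausdorffMeasure_eq_volume]
      exact (measure_mono Set.inter_subset_right).trans_lt measure_ball_lt_top

end HausdorffMeasure

section Charts

variable {d : ℕ} {M : Type*} [TopologicalSpace M]

section ChartFun

variable {f η : M → ℝ} {φ : OpenPartialHomeomorph M (Euc d)}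

theorem chartFun_apply_of_mem_source (f η : M → ℝ) {x : M} (hx : x ∈ φ.source) :
    chartFun f η φ (φ x) = f x * η x := by
  rw [chartFun, if_pos (φ.map_source hx), φ.left_inv hx]

theorem support_chartFun_subset : Function.support (chartFun f η φ) ⊆ φ '' tsupport η := by
  intro z hz
  have hz_target : z ∈ φ.target := by
    by_contra hzt
    exact hz (if_neg hzt)
  have hη : η (φ.symm z) ≠ 0 := fun h0 => hz (by rw [chartFun, if_pos hz_target, h0, mul_zero])
  exact ⟨φ.symm z, subset_tsupport η hη, φ.right_inv hz_target⟩

theorem isCompact_image_tsupport (hη : HasCompactSupport η) (hsub : tsupport η ⊆ φ.source) :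
    IsCompact (φ '' tsupport η) :=
  hη.isCompact.image_of_continuousOn (φ.continuousOn.mono hsub)

theorem hasCompactSupport_chartFun (hη : HasCompactSupport η) (hsub : tsupport η ⊆ φ.source) :
    HasCompactSupport (chartFun f η φ) :=
  .of_support_subset_isCompact (isCompact_image_tsupport hη hsub) support_chartFun_subset

theorem continuous_chartFun (hf : Continuous f) (hη : Continuous η) (hη_supp : HasCompactSupport η)
    (hsub : tsupport η ⊆ φ.source) : Continuous (chartFun f η φ) := by
  have hcont : ContinuousOn (chartFun f η φ) φ.target :=
    ((hf.mul hη).comp_continuousOn φ.symm.continuousOn).congr fun z hz => if_pos hz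
  refine hcont.continuous_of_tsupport_subset φ.open_target ?_
  refine (closure_minimal support_chartFun_subset
    (isCompact_image_tsupport hη_supp hsub).isClosed).trans ?_
  rintro _ ⟨x, hx, rfl⟩
  exact φ.map_source (hsub hx)

end ChartFun

section ChartSum

variable {J : Type*} [Fintype J] (φ : J → OpenPartialHomeomorph M (Euc d))

theorem chartSum_eq_sum_indicator (g : J → Euc d → ℝ) (x : M) :
    chartSum φ g x = ∑ j, (φ j).source.indicator (fun x => g j (φ j x)) x := by
  classical
  simp only [chartSum, Finset.sum_filter, Set.indicator_apply]

theorem chartSum_chartFun {φ : J → OpenPartialHomeomorph M (Euc d)} {η : PartitionOfUnity J M}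
    (hη : η.IsSubordinate fun j => (φ j).source) (f : M → ℝ) (x : M) :
    chartSum φ (fun j => chartFun f (η j) (φ j)) x = f x := by
  have hterm (j : J) :
      (φ j).source.indicator (fun x => chartFun f (η j) (φ j) (φ j x)) x = f x * η j x := by
    by_cases hx : x ∈ (φ j).source
    · rw [Set.indicator_of_mem hx, chartFun_apply_of_mem_source f (η j) hx]
    · have hη0 : η j x = 0 := by
        by_contra h0
        exact hx (hη j (subset_tsupport _ h0))
      rw [Set.indicator_of_notMem hx, hη0, mul_zero]
  have hsum : ∑ j, η j x = 1 := by
    rw [← finsum_eq_sum_of_fintype]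
    exact η.sum_eq_one (Set.mem_univ x)
  rw [chartSum_eq_sum_indicator, Finset.sum_congr rfl fun j _ => hterm j, ← Finset.mul_sum, hsum,
    mul_one]

theorem abs_chartSum_sub_chartSum_le {g h : J → Euc d → ℝ} {δ : ℝ} (hδ : 0 ≤ δ)
    (hgh : ∀ j, ∀ z ∈ (φ j).target, |g j z - h j z| ≤ δ) (x : M) :
    |chartSum φ g x - chartSum φ h x| ≤ Fintype.card J * δ := by
  rw [chartSum_eq_sum_indicator, chartSum_eq_sum_indicator, ← Finset.sum_sub_distrib,
    ← nsmul_eq_mul]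
  refine (Finset.abs_sum_le_sum_abs _ _).trans (Finset.sum_le_card_nsmul _ _ _ fun j _ => ?_)
  by_cases hx : x ∈ (φ j).source
  · simpa only [Set.indicator_of_mem hx] using hgh j _ ((φ j).map_source hx)
  · simpa only [Set.indicator_of_notMem hx, sub_self, abs_zero] using hδ

end ChartSum

theorem measurable_indicator_source [MeasurableSpace M] [OpensMeasurableSpace M]
    (φ : OpenPartialHomeomorph M (Euc d)) : Measurable (φ.source.indicator φ) := by
  classical
  rw [← Set.piecewise_eq_indicator]
  exact φ.continuousOn.measurable_piecewise continuousOn_const φ.open_source.measurableSet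

end Charts

section Networks

variable {d : ℕ} {ρ : ℝ → ℝ}

/-- The outer weights for which the network with `n` nodes is the empirical mean of `n` samples of
`node ρ G`. -/
noncomputable def empiricalWeights (G : Euc d × ℝ → ℝ) (n : ℕ) (wb : Fin n → Euc d × ℝ)
    (k : Fin n) : ℝ :=
  (n : ℝ)⁻¹ * G (wb k)

theorem measurable_empiricalWeights {G : Euc d × ℝ → ℝ} (hG : Measurable G) (n : ℕ) :
    Measurable (empiricalWeights G n) :=
  measurable_pi_lambda _ fun k => (hG.comp (measurable_pi_apply k)).const_mul _

theorem rvfl_empiricalWeights {S : Type*} (ρ : ℝ → ℝ) (G : Euc d × ℝ → ℝ) (α : ℝ)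
    (w y : ℕ → S → Euc d) (u : ℕ → S → ℝ) (n : ℕ) (s : S) (z : Euc d) :
    rvfl ρ α w y u n (empiricalWeights G n) s z
      = empiricalMean (node ρ G z) (fun k s => innerParam α (w k s, y k s, u k s)) n s := by
  simp only [rvfl, network, empiricalWeights, empiricalMean, node, innerParam, Finset.mul_sum,
    mul_assoc]

/-- A hidden node read in the chart `φ`, as a function of its parameters and of a point of the
manifold, extended by zero to the points outside the domain of the chart. -/
noncomputable def chartNode {M : Type*} [TopologicalSpace M] (ρ : ℝ → ℝ) (G : Euc d × ℝ → ℝ)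
    (φ : OpenPartialHomeomorph M (Euc d)) (q : (Euc d × ℝ) × M) : ℝ :=
  φ.source.indicator (fun x => node ρ G (φ x) q.1) q.2

section ChartNode

variable {M : Type*} [TopologicalSpace M]

theorem memLp_chartNode [MeasurableSpace M] [OpensMeasurableSpace M] {μ : Measure M}
    [IsFiniteMeasure μ] {G : Euc d × ℝ → ℝ} (hG : IsBoundedWeight G) {p : ENNReal}
    (hρ : MemLp ρ p volume) (φ : OpenPartialHomeomorph M (Euc d)) (T : Set (Euc d)) {α Ω : ℝ}
    (hα : 0 < α) (hΩ : 0 < Ω) : MemLp (chartNode ρ G φ) p ((innerLaw T α Ω).prod μ) := by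
  have hnode := hG.memLp_node_innerLaw_prod (μ := μ) hρ T hα hΩ (measurable_indicator_source φ)
  refine (hnode.indicator (measurable_snd φ.open_source.measurableSet)).ae_eq
    (ae_of_all _ fun q => ?_)
  by_cases hq : q.2 ∈ φ.source <;> simp [chartNode, hq]

variable {J : Type*} [Fintype J] (φ : J → OpenPartialHomeomorph M (Euc d))

theorem chartSum_rvfl_empiricalWeights {S : Type*} (ρ : ℝ → ℝ) (G : J → Euc d × ℝ → ℝ)
    (α : J → ℝ) (w y : J → ℕ → S → Euc d) (u : J → ℕ → S → ℝ) (n : J → ℕ) (s : S) (x : M) :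
    chartSum φ
        (fun j => rvfl ρ (α j) (w j) (y j) (u j) (n j) (empiricalWeights (G j) (n j)) s) x
      = ∑ j, empiricalMean (fun ξ => chartNode ρ (G j) (φ j) (ξ, x))
          (fun k s => innerParam (α j) (w j k s, y j k s, u j k s)) (n j) s := by
  simp only [chartSum_eq_sum_indicator, rvfl_empiricalWeights]
  refine Finset.sum_congr rfl fun j _ => ?_
  by_cases hx : x ∈ (φ j).source <;> simp [chartNode, empiricalMean, hx]

theorem sum_integral_chartNode (ρ : ℝ → ℝ) (G : J → Euc d × ℝ → ℝ)
    (Q : J → Measure (Euc d × ℝ)) (x : M) :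
    ∑ j, ∫ ξ, chartNode ρ (G j) (φ j) (ξ, x) ∂Q j
      = chartSum φ (fun j z => ∫ ξ, node ρ (G j) z ξ ∂Q j) x := by
  rw [chartSum_eq_sum_indicator]
  refine Finset.sum_congr rfl fun j _ => ?_
  by_cases hx : x ∈ (φ j).source <;> simp [chartNode, hx]

end ChartNode

section RandomSample

variable {J S : Type*} [MeasurableSpace S] {P : Measure S} {T : J → Set (Euc d)}
  {α Ω : J → ℝ} {w y : J → ℕ → S → Euc d} {u : J → ℕ → S → ℝ}

theorem IsRandomSample.hasLaw_innerParam (h : IsRandomSample P T α Ω w y u) (j : J) (k : ℕ) :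
    HasLaw (fun s => innerParam (α j) (w j k s, y j k s, u j k s)) (innerLaw (T j) (α j) (Ω j))
      P :=
  (HasLaw.mk (measurable_innerParam (α j)).aemeasurable rfl).comp (h.law j k)

theorem IsRandomSample.pairwise_indepFun_innerParam (h : IsRandomSample P T α Ω w y u) :
    Pairwise fun i i' : J × ℕ =>
      IndepFun (fun s => innerParam (α i.1) (w i.1 i.2 s, y i.1 i.2 s, u i.1 i.2 s))
        (fun s => innerParam (α i'.1) (w i'.1 i'.2 s, y i'.1 i'.2 s, u i'.1 i'.2 s)) P :=
  fun _ _ hii' => (h.indep.comp (fun i => innerParam (α i.1))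
    fun i => measurable_innerParam (α i.1)).indepFun hii'

variable [IsProbabilityMeasure P]

section Chart

variable {μ : Measure (Euc d)} [IsFiniteMeasure μ] {G : Euc d × ℝ → ℝ} {F : Euc d → ℝ} {j : J}

theorem IsRandomSample.integrable_chartSqError (h : IsRandomSample P T α Ω w y u)
    (hα : 0 < α j) (hΩ : 0 < Ω j) (hG : IsBoundedWeight G) (hρ : MemLp ρ 2 volume)
    (hF : MemLp F 2 μ) (n : ℕ) :
    Integrable (fun p : S × Euc d =>
      chartSqError ρ (α j) (w j) (y j) (u j) n (empiricalWeights G n) F p.1 p.2) (P.prod μ) := by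
  have hnode := hG.memLp_node_innerLaw_prod (μ := μ) hρ (T j) hα hΩ measurable_id
  simp only [chartSqError, rvfl_empiricalWeights, sq_abs]
  simpa using integrable_sub_sum_empiricalMean_sq (J := Unit) (fun _ => h.hasLaw_innerParam j) hF
    (fun _ => hnode) fun _ => n

theorem IsRandomSample.tendstoBelowAtRate_chartSqError (h : IsRandomSample P T α Ω w y u)
    (hα : 0 < α j) (hΩ : 0 < Ω j) (hG : IsBoundedWeight G) (hρ : MemLp ρ 2 volume)
    (hF : MemLp F 2 μ) {δ ε : ℝ}
    (hbias : ∀ᵐ z ∂μ, |F z - ∫ ξ, node ρ G z ξ ∂innerLaw (T j) (α j) (Ω j)| ≤ δ)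
    (hδ : δ ^ 2 * μ.real Set.univ < ε) :
    TendstoBelowAtRate atTop
      (fun n : ℕ => ∫ s, ∫ z,
        chartSqError ρ (α j) (w j) (y j) (u j) n (empiricalWeights G n) F s z ∂μ ∂P)
      (fun n => 1 / (n : ℝ)) ε := by
  have hind : Pairwise fun k k' : ℕ =>
      IndepFun (fun s => innerParam (α j) (w j k s, y j k s, u j k s))
        (fun s => innerParam (α j) (w j k' s, y j k' s, u j k' s)) P :=
    fun k k' hkk' => h.pairwise_indepFun_innerParam (i := (j, k)) (j := (j, k'))
      fun heq => hkk' (congrArg Prod.snd heq)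
  simp only [chartSqError, rvfl_empiricalWeights, sq_abs]
  have hnode := hG.memLp_node_innerLaw_prod (μ := μ) hρ (T j) hα hΩ measurable_id
  simpa only [id] using
    tendstoBelowAtRate_sub_empiricalMean (h.hasLaw_innerParam j) hind hF hnode hbias hδ

end Chart

section Manifold

variable [Fintype J] {M : Type*} [TopologicalSpace M] [MeasurableSpace M] [OpensMeasurableSpace M]
  {μ : Measure M} [IsFiniteMeasure μ] {φ : J → OpenPartialHomeomorph M (Euc d)}
  {G : J → Euc d × ℝ → ℝ} {f : M → ℝ}

theorem IsRandomSample.integrable_manifoldSqError (h : IsRandomSample P T α Ω w y u)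
    (hα : ∀ j, 0 < α j) (hΩ : ∀ j, 0 < Ω j) (hG : ∀ j, IsBoundedWeight (G j))
    (hρ : MemLp ρ 2 volume) (hf : MemLp f 2 μ) (n : J → ℕ) :
    Integrable (fun p : S × M =>
      manifoldSqError φ ρ α w y u n (fun j => empiricalWeights (G j) (n j)) f p.1 p.2)
      (P.prod μ) := by
  simp only [manifoldSqError, chartSum_rvfl_empiricalWeights, sq_abs]
  exact integrable_sub_sum_empiricalMean_sq h.hasLaw_innerParam hf
    (fun j => memLp_chartNode (hG j) hρ (φ j) (T j) (hα j) (hΩ j)) n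

theorem IsRandomSample.tendstoBelowAtRate_manifoldSqError (h : IsRandomSample P T α Ω w y u)
    (hα : ∀ j, 0 < α j) (hΩ : ∀ j, 0 < Ω j) (hG : ∀ j, IsBoundedWeight (G j))
    (hρ : MemLp ρ 2 volume) (hf : MemLp f 2 μ) {δ ε : ℝ}
    (hbias : ∀ x, |f x - chartSum φ
      (fun j z => ∫ ξ, node ρ (G j) z ξ ∂innerLaw (T j) (α j) (Ω j)) x| ≤ δ)
    (hδ : δ ^ 2 * μ.real Set.univ < ε) :
    TendstoBelowAtRate atTop
      (fun n : J → ℕ => ∫ s, ∫ x,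
        manifoldSqError φ ρ α w y u n (fun j => empiricalWeights (G j) (n j)) f s x ∂μ ∂P)
      (fun n => 1 / ⨅ j, (n j : ℝ)) ε := by
  simp only [manifoldSqError, chartSum_rvfl_empiricalWeights, sq_abs]
  refine tendstoBelowAtRate_sub_sum_empiricalMean h.hasLaw_innerParam
    h.pairwise_indepFun_innerParam hf
    (fun j => memLp_chartNode (hG j) hρ (φ j) (T j) (hα j) (hΩ j)) (ae_of_all _ fun x => ?_) hδ
  rw [sum_integral_chartNode]
  exact hbias x

end Manifold

end RandomSample

end Networks

theorem exists_pos_forall_sq_mul_lt {ι : Type*} [Finite ι] (A : ι → ℝ) {ε : ℝ} (hε : 0 < ε) :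
    ∃ δ > 0, ∀ i, δ ^ 2 * A i < ε := by
  have hlim (i : ι) : Tendsto (fun δ : ℝ => δ ^ 2 * A i) (𝓝[>] 0) (𝓝 0) := by
    have hcont : Continuous fun δ : ℝ => δ ^ 2 * A i := by fun_prop
    exact (hcont.tendsto' 0 0 (by simp)).mono_left nhdsWithin_le_nhds
  have hsmall := eventually_all.2 fun i => (hlim i).eventually_lt_const hε
  have hpos : ∀ᶠ δ in 𝓝[>] (0 : ℝ), 0 < δ := self_mem_nhdsWithin
  exact (hpos.and hsmall).exists

theorem exists_isBoundedWeight_abs_chartFun_sub_le {d : ℕ} {J M : Type*} [TopologicalSpace M]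
    [CompactSpace M] {φ : J → OpenPartialHomeomorph M (Euc d)} {η : PartitionOfUnity J M}
    (hbdd : ∀ j, Bornology.IsBounded (φ j).target)
    (hη : η.IsSubordinate fun j => (φ j).source) (f : C(M, ℝ)) {ρ : ℝ → ℝ}
    (hρ : Integrable ρ) (hρ0 : ¬ ρ =ᵐ[volume] 0) {Ω : J → ℝ} (hΩ : ∀ j, 0 < Ω j) {δ : ℝ}
    (hδ : 0 < δ) :
    ∃ α : J → ℝ, (∀ j, 0 < α j) ∧ ∃ G : J → Euc d × ℝ → ℝ, (∀ j, IsBoundedWeight (G j)) ∧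
      ∀ j, ∀ z ∈ (φ j).target, |chartFun f (η j) (φ j) z
        - ∫ ξ, node ρ (G j) z ξ ∂innerLaw (φ j).target (α j) (Ω j)| ≤ δ := by
  choose α hα G hG hbias using fun j =>
    exists_isBoundedWeight_abs_sub_integral_node_innerLaw_le hρ hρ0 (φ j).open_target (hbdd j)
      (continuous_chartFun f.continuous (η j).continuous (.of_compactSpace _) (hη j)) (hΩ j) hδ
  exact ⟨α, hα, G, hG, hbias⟩

theorem mainTheorem3_general
    {d : ℕ} {M : Type*} [TopologicalSpace M] [CompactSpace M] [MeasurableSpace M]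
    [OpensMeasurableSpace M] (μ : Measure M) [IsFiniteMeasure μ]
    {J : Type*} [Fintype J] (φ : J → OpenPartialHomeomorph M (Euc d))
    (hbdd : ∀ j, Bornology.IsBounded (φ j).target)
    (η : PartitionOfUnity J M) (hη : η.IsSubordinate (fun j => (φ j).source))
    (f : C(M, ℝ))
    (ρ : ℝ → ℝ) (hρ1 : MemLp ρ 1 volume) (hρ2 : MemLp ρ 2 volume)
    (hρ0 : ¬ ρ =ᵐ[volume] 0)
    (Ω : J → ℝ) (hΩ : ∀ j, 0 < Ω j) (ε : ℝ) (hε : 0 < ε) :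
    ∃ α : J → ℝ, (∀ j, 0 < α j) ∧
      ∃ v : J → (n : ℕ) → (Fin n → Euc d × ℝ) → Fin n → ℝ,
        (∀ j n, Measurable (v j n)) ∧
        ∀ (S : Type*) [MeasurableSpace S] (P : Measure S) [IsProbabilityMeasure P]
          (w y : J → ℕ → S → Euc d) (u : J → ℕ → S → ℝ),
          IsRandomSample P (fun j => (φ j).target) α Ω w y u →
          (∀ j,
            (∀ n : ℕ, Integrable
              (fun p : S × Euc d => chartSqError ρ (α j) (w j) (y j) (u j) n (v j n)
                (chartFun f (η j) (φ j)) p.1 p.2)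
              (P.prod ((volume : Measure (Euc d)).restrict (φ j).target))) ∧
            TendstoBelowAtRate atTop
              (fun n : ℕ => ∫ s, (∫ z in (φ j).target,
                chartSqError ρ (α j) (w j) (y j) (u j) n (v j n)
                  (chartFun f (η j) (φ j)) s z) ∂P)
              (fun n : ℕ => 1 / (n : ℝ)) ε) ∧
          (∀ n : J → ℕ, Integrable
            (fun p : S × M => manifoldSqError φ ρ α w y u n (fun j => v j (n j)) f p.1 p.2)
            (P.prod μ)) ∧
          TendstoBelowAtRate atTop
            (fun n : J → ℕ => ∫ s, (∫ x : M,
              manifoldSqError φ ρ α w y u n (fun j => v j (n j)) f s x ∂μ) ∂P)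
            (fun n : J → ℕ => 1 / ⨅ j, (n j : ℝ)) ε := by
  obtain ⟨δ, hδ, hδ_small⟩ := exists_pos_forall_sq_mul_lt (fun i : Option J =>
    i.elim ((Fintype.card J : ℝ) ^ 2 * μ.real Set.univ) fun j => volume.real (φ j).target) hε
  obtain ⟨α, hα, G, hG, hbias⟩ := exists_isBoundedWeight_abs_chartFun_sub_le hbdd hη f
    (memLp_one_iff_integrable.1 hρ1) hρ0 hΩ hδ
  refine ⟨α, hα, fun j => empiricalWeights (G j),
    fun j => measurable_empiricalWeights (hG j).measurable, fun S _ P _ w y u hsample =>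
    ⟨fun j => ?_, ?_⟩⟩
  · have : IsFiniteMeasure (volume.restrict (φ j).target) :=
      isFiniteMeasure_restrict.2 (hbdd j).measure_lt_top.ne
    have hF : MemLp (chartFun f (η j) (φ j)) 2 (volume.restrict (φ j).target) :=
      ((continuous_chartFun f.continuous (η j).continuous (.of_compactSpace _)
        (hη j)).memLp_of_hasCompactSupport
          (hasCompactSupport_chartFun (.of_compactSpace _) (hη j))).restrict _
    refine ⟨hsample.integrable_chartSqError (hα j) (hΩ j) (hG j) hρ2 hF,
      hsample.tendstoBelowAtRate_chartSqError (hα j) (hΩ j) (hG j) hρ2 hF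
        (ae_restrict_of_forall_mem (φ j).open_target.measurableSet (hbias j)) ?_⟩
    simpa using hδ_small (some j)
  · have hf : MemLp f 2 μ :=
      .of_bound f.continuous.aestronglyMeasurable ‖f‖ (ae_of_all _ f.norm_coe_le_norm)
    refine ⟨hsample.integrable_manifoldSqError hα hΩ hG hρ2 hf,
      hsample.tendstoBelowAtRate_manifoldSqError (δ := Fintype.card J * δ) hα hΩ hG hρ2 hf
        (fun x => ?_) ?_⟩
    · rw [← chartSum_chartFun hη f x]
      exact abs_chartSum_sub_chartSum_le φ hδ.le hbias x
    · simpa [mul_pow, mul_left_comm, mul_assoc] using hδ_small none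

theorem mainTheorem3
    {N d : ℕ}
    -- a compact smooth embedded submanifold `M` of `ℝ^N` of dimension `d`
    (M : Set (Euc N)) (hMc : IsCompact M)
    [ChartedSpace (Euc d) M] [IsManifold (𝓡 d) ∞ M]
    (hM : Manifold.IsSmoothEmbedding (𝓡 d) (𝓡 N) ∞ (Subtype.val : M → Euc N))
    -- a finite atlas of charts with bounded images
    {J : Type*} [Fintype J] (φ : J → OpenPartialHomeomorph M (Euc d))
    (hcover : ∀ x : M, ∃ j, x ∈ (φ j).source)
    (hbdd : ∀ j, Bornology.IsBounded (φ j).target)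
    -- a partition of unity subordinate to the atlas
    (η : PartitionOfUnity J M) (hη : η.IsSubordinate (fun j => (φ j).source))
    (f : C(M, ℝ))
    -- the activation function
    (ρ : ℝ → ℝ) (hρ1 : MemLp ρ 1 volume) (hρ2 : MemLp ρ 2 volume)
    (hρ0 : ¬ ρ =ᵐ[volume] 0)
    (ε : ℝ) (hε : 0 < ε) :
    ∃ α Ω : J → ℝ, (∀ j, 0 < α j ∧ 0 < Ω j) ∧
      -- the outer weights of the network with `n` nodes on the chart `j`,
      -- as functions of the inner weights and biases of that network
      ∃ v : J → (n : ℕ) → (Fin n → Euc d × ℝ) → Fin n → ℝ,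
        (∀ j n, Measurable (v j n)) ∧
        ∀ (S : Type*) [MeasurableSpace S] (P : Measure S) [IsProbabilityMeasure P]
          (w y : J → ℕ → S → Euc d) (u : J → ℕ → S → ℝ),
          IsRandomSample P (fun j => (φ j).target) α Ω w y u →
          -- each network approximates its chart function on `φ_j(U_j)`
          (∀ j,
            (∀ n : ℕ, Integrable
              (fun p : S × Euc d => chartSqError ρ (α j) (w j) (y j) (u j) n (v j n)
                (chartFun f (η j) (φ j)) p.1 p.2)
              (P.prod ((volume : Measure (Euc d)).restrict (φ j).target))) ∧
            TendstoBelowAtRate atTop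
              (fun n : ℕ => ∫ s, (∫ z in (φ j).target,
                chartSqError ρ (α j) (w j) (y j) (u j) n (v j n)
                  (chartFun f (η j) (φ j)) s z) ∂P)
              (fun n : ℕ => 1 / (n : ℝ)) ε) ∧
          -- the sum of the networks approximates `f` on `M`, with respect to the volume of `M`
          (∀ n : J → ℕ, Integrable
            (fun p : S × M => manifoldSqError φ ρ α w y u n (fun j => v j (n j)) f p.1 p.2)
            (P.prod (Measure.euclideanHausdorffMeasure d : Measure M))) ∧
          TendstoBelowAtRate atTop
            (fun n : J → ℕ => ∫ s, (∫ x : M,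
              manifoldSqError φ ρ α w y u n (fun j => v j (n j)) f s x
                ∂(Measure.euclideanHausdorffMeasure d)) ∂P)
            (fun n : J → ℕ => 1 / ⨅ j, (n j : ℝ)) ε := by
  have : CompactSpace M := isCompact_iff_compactSpace.1 hMc
  have : IsManifold (𝓡 d) 1 M := .of_le (n := ∞) (by norm_num)
  have : IsFiniteMeasure (Measure.euclideanHausdorffMeasure d : Measure M) :=
    isFiniteMeasure_euclideanHausdorffMeasure (hM.contMDiff.of_le (by norm_num))
      isometry_subtype_coe.antilipschitz
  obtain ⟨α, hα, hv⟩ := mainTheorem3_general (Measure.euclideanHausdorffMeasure d) φ hbdd η hη f ρ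
    hρ1 hρ2 hρ0 (fun _ => 1) (fun _ => one_pos) ε hε
  exact ⟨α, fun _ => 1, fun j => ⟨hα j, one_pos⟩, hv⟩
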